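/- Let $k$ be an algebraically closed field of characteristic zero. All coalgebras are coassociative, cocommutative and counital. **Setup.** For a finite-dimensional $k$-vector space $V$ of dimension $n$ let $R=\operatorname{Sym}(V^*)$, and for $P\in V$ let $\mathfrak m_P\subseteq R$ be the maximal ideal of polynomial functions vanishing at $P$. Put $\operatorname{LC}(V,P)=H^n_{\mathfrak m_P}(R,\Omega^n_{R/k})$, with residue map $\operatorname{Res}_P:\operatorname{LC}(V,P)\to k$. Choosing a basis $e_1,\dots,e_n$ of $V$ with dual basis $x_1,\dots,x_n$, and writing $z_i=x_i-P_i$, the local cohomology is the top Čech cohomology of $\Omega^n_{R/k}$ with respect to $z_1,\dots,z_n$; it has as $k$-basis the generalised fractions $\left[\frac{dz_1\wedge\cdots\wedge dz_n}{z_1^{a_1+1},\dots,z_n^{a_n+1}}\right]$ with $a_i\ge 0$, and $\operatorname{Res}_P$ is $1$ on the one with $a=0$ and $0$ on the others. The vacuum at $P$ is $|0\rangle_P=\left[\frac{dz_1\wedge\cdots\wedge dz_n}{z_1,\dots,z_n}\right]$. The map $\eta\mapsto \operatorname{Res}_P((-)\,\eta)$ is an isomorphism of $\operatorname{LC}(V,P)$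 with the space of linear functionals $R\to k$ that vanish on a power of $\mathfrak m_P$. Through it, * $\operatorname{LC}(V,P)$ is a coalgebra, with coproduct dual to the multiplication of $R$ and counit $\operatorname{Res}_P$; * the symmetric algebra $\operatorname{Sym}(V)$ acts on $\operatorname{LC}(V,P)$ by constant-coefficient differential operators: $v\in V$ acts on $R$ as the derivation $\partial_v$ with $\partial_v(\xi)=\xi(v)$ for $\xi\in V^*$, this extends to an algebra map $t\mapsto\partial_t$ from $\operatorname{Sym}(V)$ to the differential operators on $R$, and $t\cdot\eta$ is determined by $\operatorname{Res}_P(f\,(t\cdot\eta))=\operatorname{Res}_P(\partial_t(f)\,\eta)$ for all $f\in R$. A tensor in $V^{\otimes l}$ acts through its image in $\operatorname{Sym}(V)$. Let ${!}V=\bigoplus_{P\in V}\operatorname{LC}(V,P)$ be the direct sum coalgebra, and let $d:{!}V\to V$ be the linear map given on $\operatorname{LC}(V,P)$ by $d(\eta)=\sum_i\operatorname{Res}_P(x_i\eta)\,e_i$. For $P,\nu_1,\dots,\nu_s\in V$ put $|\nu_1,\dots,\nu_s\rangle_P=\nu_1\cdots\nu_s\cdot|0\rangle_P$, and for $I=\{i_1,\dots,i_r\}\subseteq\{1,\dots,s\}$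 put $|\nu_I\rangle_P=|\nu_{i_1},\dots,\nu_{i_r}\rangle_P$. **Theorem.** Let $W,V$ be finite-dimensional $k$-vector spaces and $\phi:{!}W\to V$ a linear map. There is a unique morphism of coalgebras $\Phi:{!}W\to{!}V$ with $d\circ\Phi=\phi$, and it is given by $$\Phi|\nu_1,\dots,\nu_s\rangle_P=\sum_{C}\big(\phi|\nu_{C_1}\rangle_P\otimes\cdots\otimes\phi|\nu_{C_l}\rangle_P\big)\cdot|0\rangle_Q$$ for all $s\ge 0$ and $P,\nu_1,\dots,\nu_s\in W$, where $Q=\phi|0\rangle_P$ and the sum is over all partitions $C=\{C_1,\dots,C_l\}$ of the set $\{1,\dots,s\}$ into non-empty blocks. In particular $\Phi|0\rangle_P=|0\rangle_Q$. -/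

import Mathlib

open scoped TensorProduct

noncomputable section

namespace CofreeCoalgebra

/-- The ring `R = Sym(V*)` of polynomial functions on `V`. -/
def Poly (k V : Type*) [Field k] [AddCommGroup V] [Module k V] : Type _ :=
  SymmetricAlgebra k (Module.Dual k V)

section Setup

variable {k : Type*} [Field k] {V : Type*} [AddCommGroup V] [Module k V] {n : ℕ}

instance : CommRing (Poly k V) := inferInstanceAs (CommRing (SymmetricAlgebra k (Module.Dual k V)))
instance : Algebra k (Poly k V) :=
  inferInstanceAs (Algebra k (SymmetricAlgebra k (Module.Dual k V)))

/-- The inclusion `V* ⊆ Sym(V*)`. -/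
def linForm : Module.Dual k V →ₗ[k] Poly k V := SymmetricAlgebra.ι k (Module.Dual k V)

/-- The universal property of `Sym(V*)`. -/
def polyLift {A : Type*} [CommRing A] [Algebra k A] (f : Module.Dual k V →ₗ[k] A) :
    Poly k V →ₐ[k] A :=
  (SymmetricAlgebra.lift f : SymmetricAlgebra k (Module.Dual k V) →ₐ[k] A)

theorem polyLift_linForm {A : Type*} [CommRing A] [Algebra k A] (f : Module.Dual k V →ₗ[k] A)
    (ξ : Module.Dual k V) : polyLift f (linForm ξ) = f ξ :=
  SymmetricAlgebra.lift_ι_apply f ξ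

theorem poly_induction {motive : Poly k V → Prop}
    (algebraMap : ∀ r, motive (algebraMap k (Poly k V) r)) (linForm : ∀ ξ, motive (linForm ξ))
    (mul : ∀ f g, motive f → motive g → motive (f * g))
    (add : ∀ f g, motive f → motive g → motive (f + g)) (f : Poly k V) : motive f :=
  SymmetricAlgebra.induction (R := k) (M := Module.Dual k V) (motive := motive)
    algebraMap linForm mul add f

theorem adjoin_linForm :
    Algebra.adjoin k (Set.range (linForm : Module.Dual k V →ₗ[k] Poly k V)) = ⊤ := by
  rw [eq_top_iff]
  rintro f -
  induction f using poly_induction with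
  | algebraMap r => exact Subalgebra.algebraMap_mem _ r
  | linForm ξ => exact Algebra.subset_adjoin ⟨ξ, rfl⟩
  | mul f g hf hg => exact mul_mem hf hg
  | add f g hf hg => exact add_mem hf hg

/-- The algebra map `f ↦ f + ε ∂_v f` from `R` to `R[ε]/(ε²)`, fixed by `ξ ↦ ξ + ε ξ(v)`. -/
def dualNumberLift (v : V) : Poly k V →ₐ[k] TrivSqZeroExt (Poly k V) (Poly k V) :=
  polyLift
    ((TrivSqZeroExt.inlAlgHom k (Poly k V) (Poly k V)).toLinearMap ∘ₗ
        linForm +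
      (TrivSqZeroExt.inrHom (Poly k V) (Poly k V)).restrictScalars k ∘ₗ
        Algebra.linearMap k (Poly k V) ∘ₗ Module.Dual.eval k V v)

theorem fst_dualNumberLift (v : V) (f : Poly k V) : (dualNumberLift v f).fst = f := by
  have h : (TrivSqZeroExt.fstHom k (Poly k V) (Poly k V)).comp (dualNumberLift v)
      = AlgHom.id k (Poly k V) := by
    apply AlgHom.ext_of_adjoin_eq_top adjoin_linForm
    rintro _ ⟨ξ, rfl⟩
    simp [dualNumberLift, polyLift_linForm]
  exact congr($h f)

/-- The derivation `∂_v` of `R` along `v ∈ V`: the one with `∂_v ξ = ξ(v)` for `ξ ∈ V*`. -/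
def partialDeriv (k : Type*) [Field k] {V : Type*} [AddCommGroup V] [Module k V] (v : V) : Derivation k (Poly k V) (Poly k V) :=
  Derivation.mk' ((TrivSqZeroExt.sndHom (Poly k V) (Poly k V)).restrictScalars k ∘ₗ
      (dualNumberLift v).toLinearMap) (fun f g => by
    simp [TrivSqZeroExt.snd_mul, fst_dualNumberLift, mul_comm])

theorem partialDeriv_linForm (v : V) (ξ : Module.Dual k V) :
    partialDeriv k v (linForm ξ) = algebraMap k (Poly k V) (ξ v) := by
  simp [partialDeriv, dualNumberLift, polyLift_linForm, Algebra.algebraMap_eq_smul_one]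

theorem partialDeriv_add (v w : V) :
    (partialDeriv k (v + w) : Derivation k (Poly k V) (Poly k V))
      = partialDeriv k v + partialDeriv k w := by
  apply Derivation.ext_of_adjoin_eq_top _ adjoin_linForm
  rintro _ ⟨ξ, rfl⟩
  simp [partialDeriv_linForm]

theorem partialDeriv_smul (c : k) (v : V) :
    (partialDeriv k (c • v) : Derivation k (Poly k V) (Poly k V)) = c • partialDeriv k v := by
  apply Derivation.ext_of_adjoin_eq_top _ adjoin_linForm
  rintro _ ⟨ξ, rfl⟩
  simp [partialDeriv_linForm, Algebra.smul_def]

theorem partialDeriv_comm (v w : V) (f : Poly k V) :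
    partialDeriv k v (partialDeriv k w f) = partialDeriv k w (partialDeriv k v f) := by
  have h : ⁅(partialDeriv k v : Derivation k (Poly k V) (Poly k V)), partialDeriv k w⁆ = 0 := by
    apply Derivation.ext_of_adjoin_eq_top _ adjoin_linForm
    rintro _ ⟨ξ, rfl⟩
    simp [Derivation.commutator_apply, partialDeriv_linForm]
  have := congr($h f)
  rwa [Derivation.commutator_apply, Derivation.zero_apply, sub_eq_zero] at this

/-- The map `V → D(R) ⊆ End_k(R)`, `v ↦ ∂_v`. -/
def partialDerivHom (k V : Type*) [Field k] [AddCommGroup V] [Module k V] :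
    V →ₗ[k] Module.End k (Poly k V) where
  toFun v := (partialDeriv k v : Poly k V →ₗ[k] Poly k V)
  map_add' v w := by rw [partialDeriv_add]; rfl
  map_smul' c v := by rw [partialDeriv_smul]; rfl

/-- The extension of `v ↦ ∂_v` to an algebra map from `Sym(V)` to the ring of differential
operators on `R`, inside `End_k(R)`. -/
def diffOp (k V : Type*) [Field k] [AddCommGroup V] [Module k V] :
    SymmetricAlgebra k V →ₐ[k] Module.End k (Poly k V) :=
  RingCon.liftₐ _ (TensorAlgebra.lift k (partialDerivHom k V)) (by
    refine RingCon.ringConGen_le.2 ?_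
    intro x y h
    induction h with
    | mul_comm v w =>
      rw [RingCon.ker_apply]
      simp only [AlgHom.toRingHom_eq_coe, map_mul, RingHom.coe_coe, TensorAlgebra.lift_ι_apply]
      ext f
      exact partialDeriv_comm v w f)

theorem diffOp_ι (v : V) (f : Poly k V) :
    diffOp k V (SymmetricAlgebra.ι k V v) f = partialDeriv k v f := by
  change TensorAlgebra.lift k (partialDerivHom k V) (TensorAlgebra.ι k v) f = _
  rw [TensorAlgebra.lift_ι_apply]
  rfl

/-- The local coordinate `z_i = x_i - P_i` at `P`, where `x_i` is the `i`-th coordinate function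
for the basis `b`. -/
def localCoord (b : Module.Basis (Fin n) k V) (P : V) (i : Fin n) : Poly k V :=
  linForm (b.coord i) - algebraMap k (Poly k V) (b.coord i P)

/-- The monomial `z^a` in the local coordinates at `P`. -/
def localMonomial (b : Module.Basis (Fin n) k V) (P : V) (a : Fin n → ℕ) : Poly k V :=
  ∏ i, localCoord b P i ^ a i

/-- The maximal ideal `m_P = (z_1, …, z_n)`. -/
def maxIdeal (b : Module.Basis (Fin n) k V) (P : V) : Ideal (Poly k V) :=
  Ideal.span (Set.range (localCoord b P))

/-- The module `Ω^n_{R/k}` of top-degree differential forms. -/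
abbrev TopForms (k V : Type*) [Field k] [AddCommGroup V] [Module k V] (n : ℕ) : Type _ :=
  ⋀[Poly k V]^n (KaehlerDifferential k (Poly k V))

/-- The form `dz_1 ∧ ⋯ ∧ dz_n`. -/
def volForm (b : Module.Basis (Fin n) k V) (P : V) : TopForms k V n :=
  exteriorPower.ιMulti (Poly k V) n
    (fun i => KaehlerDifferential.D k (Poly k V) (localCoord b P i))

/-- The multiplicative set generated by the local coordinates at `P`. -/
def denominators (b : Module.Basis (Fin n) k V) (P : V) : Submonoid (Poly k V) :=
  Submonoid.closure (Set.range (localCoord b P))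

/-- The localisation `Ω^n[1/(z_1 ⋯ z_n)]`, the last term of the Čech complex of `Ω^n` with
respect to `z_1, …, z_n`. -/
abbrev CechTop (b : Module.Basis (Fin n) k V) (P : V) : Type _ :=
  LocalizedModule (denominators b P) (TopForms k V n)

instance (b : Module.Basis (Fin n) k V) (P : V) : AddCommGroup (CechTop b P) :=
  OreLocalization.instAddCommGroup

/-- The image of the last Čech differential: the sum over `i` of the images of the localisations
of `Ω^n` in which all `z_j` with `j ≠ i` are inverted. -/
def cechBoundary (b : Module.Basis (Fin n) k V) (P : V) : Submodule (Poly k V) (CechTop b P) :=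
  Submodule.span (Poly k V) {x | ∃ i : Fin n,
    ∃ s ∈ Submonoid.closure (localCoord b P '' {i}ᶜ), ∃ ω : TopForms k V n,
      s • x = LocalizedModule.mkLinearMap (denominators b P) (TopForms k V n) ω}

/-- The local cohomology module `H^n_{m_P}(R, Ω^n_{R/k})`, as the top cohomology of the Čech
complex. -/
def LocalCoh (b : Module.Basis (Fin n) k V) (P : V) : Type _ :=
  CechTop b P ⧸ cechBoundary b P

variable (b : Module.Basis (Fin n) k V) (P : V)

instance : AddCommGroup (LocalCoh b P) :=
  inferInstanceAs (AddCommGroup (CechTop b P ⧸ cechBoundary b P))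
instance : Module (Poly k V) (LocalCoh b P) :=
  inferInstanceAs (Module (Poly k V) (CechTop b P ⧸ cechBoundary b P))
instance : Module k (LocalCoh b P) :=
  inferInstanceAs (Module k (CechTop b P ⧸ cechBoundary b P))
instance : IsScalarTower k (Poly k V) (LocalCoh b P) :=
  inferInstanceAs (IsScalarTower k (Poly k V) (CechTop b P ⧸ cechBoundary b P))

theorem localMonomial_mem (a : Fin n → ℕ) : localMonomial b P a ∈ denominators b P :=
  Submonoid.prod_mem _ fun i _ => Submonoid.pow_mem _ (Submonoid.subset_closure (Set.mem_range_self i)) _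

/-- The class of a meromorphic form. -/
def toLocalCoh : CechTop b P →ₗ[Poly k V] LocalCoh b P := (cechBoundary b P).mkQ

theorem toLocalCoh_surjective : Function.Surjective (toLocalCoh b P) :=
  Submodule.mkQ_surjective _

theorem toLocalCoh_eq_zero {x : CechTop b P} : toLocalCoh b P x = 0 ↔ x ∈ cechBoundary b P :=
  Submodule.Quotient.mk_eq_zero _

/-- The generalised fraction `[ω / z_1^{c_1}, …, z_n^{c_n}]`. -/
def genFrac (ω : TopForms k V n) (c : Fin n → ℕ) : LocalCoh b P :=
  toLocalCoh b P
    (LocalizedModule.mk ω (⟨localMonomial b P c, localMonomial_mem b P c⟩ : denominators b P))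

theorem genFrac_smul (f : Poly k V) (ω : TopForms k V n) (c : Fin n → ℕ) :
    genFrac b P (f • ω) c = f • genFrac b P ω c := by
  rw [genFrac, genFrac, ← map_smul, LocalizedModule.smul'_mk]

/-- The generalised fraction `[dz / z_1^{a_1+1}, …, z_n^{a_n+1}]`. -/
def residueSymbol (a : Fin n → ℕ) : LocalCoh b P :=
  genFrac b P (volForm b P) (fun i => a i + 1)

/-- The vacuum `|0⟩_P = [dz / z_1, …, z_n]`. -/
def vacuum : LocalCoh b P := residueSymbol b P 0

/-- Laurent polynomials in the local coordinates at `P`. -/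
def Laurent (_b : Module.Basis (Fin n) k V) (_P : V) : Type _ := AddMonoidAlgebra k (Fin n → ℤ)

instance : CommRing (Laurent b P) := inferInstanceAs (CommRing (AddMonoidAlgebra k (Fin n → ℤ)))
instance : Algebra k (Laurent b P) :=
  inferInstanceAs (Algebra k (AddMonoidAlgebra k (Fin n → ℤ)))

/-- `Laurent b P` as an algebra over `k` only. -/
def ofLaurent : Laurent b P ≃ₐ[k] AddMonoidAlgebra k (Fin n → ℤ) :=
  (AlgEquiv.refl : AddMonoidAlgebra k (Fin n → ℤ) ≃ₐ[k] AddMonoidAlgebra k (Fin n → ℤ))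

/-- The Laurent monomial `z^e`. -/
def laurentMonomial (e : Fin n → ℤ) : Laurent b P :=
  (ofLaurent b P).symm (AddMonoidAlgebra.single e 1)

/-- The coefficient of `z^e` in a Laurent polynomial. -/
def laurentCoeff (e : Fin n → ℤ) : Laurent b P →ₗ[k] k where
  toFun x := (ofLaurent b P x).coeff e
  map_add' x y := by simp
  map_smul' c x := by simp

/-- The expansion of a polynomial function in the local coordinates at `P`. -/
def expand : Poly k V →ₐ[k] Laurent b P :=
  polyLift
    (Algebra.linearMap k (Laurent b P) ∘ₗ Module.Dual.eval k V P +
      ∑ i, (LinearMap.toSpanSingleton k (Laurent b P) (laurentMonomial b P (Pi.single i 1))) ∘ₗ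
        Module.Dual.eval k V (b i))

instance : Algebra (Poly k V) (Laurent b P) := (expand b P).toRingHom.toAlgebra

instance : IsScalarTower k (Poly k V) (Laurent b P) :=
  IsScalarTower.of_algebraMap_eq fun c => ((expand b P).commutes c).symm

theorem laurentMonomial_add (e e' : Fin n → ℤ) :
    laurentMonomial b P (e + e') = laurentMonomial b P e * laurentMonomial b P e' := by
  rw [laurentMonomial, laurentMonomial, laurentMonomial, ← map_mul,
    AddMonoidAlgebra.single_mul_single, one_mul]

theorem laurentMonomial_zero : laurentMonomial b P 0 = 1 := by
  rw [laurentMonomial, ← AddMonoidAlgebra.one_def, map_one]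

theorem laurentCoeff_monomial (e e' : Fin n → ℤ) :
    laurentCoeff b P e (laurentMonomial b P e') = if e' = e then 1 else 0 := by
  simp [laurentCoeff, laurentMonomial, Finsupp.single_apply]

theorem laurentCoeff_monomial_mul (e e' : Fin n → ℤ) (x : Laurent b P) :
    laurentCoeff b P (e' + e) (laurentMonomial b P e' * x) = laurentCoeff b P e x := by
  simp [laurentCoeff, laurentMonomial]

theorem expand_localCoord (i : Fin n) :
    expand b P (localCoord b P i) = laurentMonomial b P (Pi.single i 1) := by
  rw [localCoord, map_sub, AlgHom.commutes, expand, polyLift_linForm]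
  simp only [LinearMap.add_apply, LinearMap.comp_apply, Module.Dual.eval_apply,
    LinearMap.sum_apply, Module.Basis.coord_apply, Module.Basis.repr_self,
    LinearMap.toSpanSingleton_apply, Algebra.linearMap_apply]
  rw [Finset.sum_eq_single i]
  · simp
  · intro j _ hj
    simp [hj]
  · simp

theorem expand_localMonomial (a : Fin n → ℕ) :
    expand b P (localMonomial b P a) = laurentMonomial b P (fun i => (a i : ℤ)) := by
  have hpow : ∀ (i : Fin n) (m : ℕ), laurentMonomial b P (Pi.single i 1) ^ m =
      laurentMonomial b P (Pi.single i (m:ℤ)) := by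
    intro i m
    induction m with
    | zero => simp [laurentMonomial_zero]
    | succ m ih => rw [pow_succ, ih, ← laurentMonomial_add, ← Pi.single_add]; push_cast; rfl
  have hs : ∀ s : Finset (Fin n), ∏ i ∈ s, laurentMonomial b P (Pi.single i (a i:ℤ)) =
      laurentMonomial b P (∑ i ∈ s, Pi.single i (a i:ℤ)) := by
    intro s
    induction s using Finset.induction_on with
    | empty => simp [laurentMonomial_zero]
    | insert i s hi ih => rw [Finset.prod_insert hi, Finset.sum_insert hi, ih, laurentMonomial_add]
  rw [localMonomial, map_prod]
  simp_rw [map_pow, expand_localCoord, hpow]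
  rw [hs, Finset.univ_sum_single]

/-- The coefficient of a top-degree form with respect to `dx_1 ∧ ⋯ ∧ dx_n`: on
`dr_1 ∧ ⋯ ∧ dr_n` it is the Jacobian determinant `det (∂r_i / ∂x_j)`. -/
def formCoeff : TopForms k V n →ₗ[Poly k V] Poly k V :=
  exteriorPower.alternatingMapLinearEquiv
    (Matrix.detRowAlternating.compLinearMap
      (LinearMap.pi fun j => (partialDeriv k (b j)).liftKaehlerDifferential))

theorem partialDeriv_localCoord (i j : Fin n) :
    partialDeriv k (b j) (localCoord b P i) = if i = j then 1 else 0 := by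
  rw [localCoord, map_sub, Derivation.map_algebraMap, partialDeriv_linForm]
  simp only [Module.Basis.coord_apply, Module.Basis.repr_self, Finsupp.single_apply, sub_zero]
  by_cases h : i = j
  · simp [h]
  · simp [h, Ne.symm h]

theorem formCoeff_volForm : formCoeff b (volForm b P) = 1 := by
  rw [formCoeff, volForm, exteriorPower.alternatingMapLinearEquiv_apply_ιMulti]
  rw [AlternatingMap.compLinearMap_apply]
  have : (fun i => (LinearMap.pi fun j => (partialDeriv k (b j)).liftKaehlerDifferential)
      (KaehlerDifferential.D k (Poly k V) (localCoord b P i))) = (1 : Matrix (Fin n) (Fin n) (Poly k V)) := by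
    ext i j
    simp only [LinearMap.pi_apply, Derivation.liftKaehlerDifferential_comp_D,
      partialDeriv_localCoord, Matrix.one_apply]
  exact (congrArg Matrix.det this).trans Matrix.det_one


theorem mem_denominators {s : Poly k V} (hs : s ∈ denominators b P) :
    ∃ c : Fin n → ℕ, s = localMonomial b P c := by
  obtain ⟨a, ha⟩ := Submonoid.mem_closure_range_iff_of_fintype.1 hs
  exact ⟨a, ha⟩

theorem isUnit_expand {s : Poly k V} (hs : s ∈ denominators b P) : IsUnit (expand b P s) := by
  obtain ⟨c, rfl⟩ := mem_denominators b P hs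
  rw [expand_localMonomial]
  refine IsUnit.of_mul_eq_one (laurentMonomial b P (fun i => -(c i : ℤ))) ?_
  rw [← laurentMonomial_add, ← laurentMonomial_zero]
  congr 1
  ext i
  simp

theorem smul_laurent (f : Poly k V) (x : Laurent b P) : f • x = expand b P f * x := rfl

theorem isUnit_end_laurent (s : denominators b P) :
    IsUnit (algebraMap (Poly k V) (Module.End (Poly k V) (Laurent b P)) s) := by
  rw [Module.End.isUnit_iff]
  obtain ⟨u, hu⟩ := isUnit_expand b P s.2
  have : ∀ x, algebraMap (Poly k V) (Module.End (Poly k V) (Laurent b P)) s x = u * x := by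
    intro x
    rw [Module.algebraMap_end_apply, smul_laurent, hu]
  constructor
  · intro x y h
    rw [this, this] at h
    exact u.isUnit.mul_left_cancel h
  · intro y
    exact ⟨(u⁻¹ : (Laurent b P)ˣ) * y, by rw [this, Units.mul_inv_cancel_left]⟩

/-- The Laurent expansion at `P` of the coefficient of a meromorphic form:
`ω / s` goes to `formCoeff ω / s`. -/
def laurentForm : CechTop b P →ₗ[Poly k V] Laurent b P :=
  LocalizedModule.lift (denominators b P)
    ((Algebra.linearMap (Poly k V) (Laurent b P)) ∘ₗ formCoeff b) (isUnit_end_laurent b P)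

theorem laurentForm_mkLinearMap (ω : TopForms k V n) :
    laurentForm b P (LocalizedModule.mkLinearMap (denominators b P) (TopForms k V n) ω)
      = expand b P (formCoeff b ω) := by
  rw [laurentForm, LocalizedModule.mkLinearMap_apply, LocalizedModule.lift_mk_one]
  rfl

theorem expand_mul_laurentForm_mk (ω : TopForms k V n) (s : denominators b P) :
    expand b P s * laurentForm b P (LocalizedModule.mk ω s) = expand b P (formCoeff b ω) := by
  rw [← smul_laurent, ← map_smul, ← laurentForm_mkLinearMap, LocalizedModule.mkLinearMap_apply]
  congr 1
  rw [LocalizedModule.smul'_mk]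
  exact LocalizedModule.mk_cancel s ω

theorem localMonomial_add (a c : Fin n → ℕ) :
    localMonomial b P (a + c) = localMonomial b P a * localMonomial b P c := by
  simp [localMonomial, pow_add, Finset.prod_mul_distrib]

theorem localMonomial_zero : localMonomial b P 0 = 1 := by simp [localMonomial]

theorem localMonomial_single (i : Fin n) (m : ℕ) :
    localMonomial b P (Pi.single i m) = localCoord b P i ^ m := by
  rw [localMonomial, Finset.prod_eq_single i]
  · simp
  · intro j _ hj; simp [hj]
  · simp

theorem linForm_eq (ξ : Module.Dual k V) :
    linForm ξ = algebraMap k (Poly k V) (ξ P) + ∑ i, ξ (b i) • localCoord b P i := by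
  have h1 : ξ = ∑ i, ξ (b i) • b.coord i := by
    apply b.ext
    intro j
    simp
  have h2 : ξ P = ∑ i, ξ (b i) * b.coord i P := by
    conv_lhs => rw [h1]
    simp only [LinearMap.sum_apply, LinearMap.smul_apply, smul_eq_mul]
  conv_lhs => rw [h1]
  rw [h2]
  simp only [localCoord, map_sum, map_smul, map_mul, Algebra.smul_def, mul_sub,
    Finset.sum_sub_distrib]
  ring

theorem span_localMonomial : Submodule.span k (Set.range (localMonomial b P)) = ⊤ := by
  rw [eq_top_iff]
  rintro f -
  have hone : (1 : Poly k V) ∈ Submodule.span k (Set.range (localMonomial b P)) :=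
    Submodule.subset_span ⟨0, localMonomial_zero b P⟩
  induction f using poly_induction with
  | algebraMap r =>
    rw [Algebra.algebraMap_eq_smul_one]
    exact Submodule.smul_mem _ _ hone
  | linForm ξ =>
    rw [linForm_eq b P, Algebra.algebraMap_eq_smul_one]
    refine Submodule.add_mem _ (Submodule.smul_mem _ _ hone) (Submodule.sum_mem _ fun i _ =>
      Submodule.smul_mem _ _ (Submodule.subset_span ⟨Pi.single i 1, ?_⟩))
    rw [localMonomial_single, pow_one]
  | mul f g hf hg =>
    have h := Submodule.mul_mem_mul hf hg
    rw [Submodule.span_mul_span] at h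
    refine Submodule.span_mono ?_ h
    rintro _ ⟨_, ⟨a, rfl⟩, _, ⟨c, rfl⟩, rfl⟩
    exact ⟨a + c, localMonomial_add b P a c⟩
  | add f g hf hg => exact Submodule.add_mem _ hf hg

/-- The expansion of a polynomial function has no negative exponents. -/
theorem laurentCoeff_expand (f : Poly k V) (e : Fin n → ℤ) {i : Fin n} (he : e i < 0) :
    laurentCoeff b P e (expand b P f) = 0 := by
  have hf : f ∈ Submodule.span k (Set.range (localMonomial b P)) := by
    rw [span_localMonomial]; trivial
  induction hf using Submodule.span_induction with
  | mem f hf =>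
    obtain ⟨a, rfl⟩ := hf
    rw [expand_localMonomial, laurentCoeff_monomial, if_neg]
    rintro rfl
    simp at he
    omega
  | zero => simp
  | add f g _ _ hf hg => rw [map_add, map_add, hf, hg, add_zero]
  | smul c f _ hf => rw [map_smul, map_smul, hf, smul_zero]

/-- The residue of a meromorphic form: the coefficient of `z_1⁻¹ ⋯ z_n⁻¹ dz`. -/
def residueForm : CechTop b P →ₗ[k] k :=
  laurentCoeff b P (fun _ => -1) ∘ₗ (laurentForm b P).restrictScalars k

theorem exists_expand_of_mem {i : Fin n} {s : Poly k V}
    (hs : s ∈ Submonoid.closure (localCoord b P '' {i}ᶜ)) :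
    ∃ e : Fin n → ℤ, e i = 0 ∧ expand b P s = laurentMonomial b P e := by
  induction hs using Submonoid.closure_induction with
  | mem s hs =>
    obtain ⟨j, hj, rfl⟩ := hs
    exact ⟨Pi.single j 1, by simp [Ne.symm hj], expand_localCoord b P j⟩
  | one => exact ⟨0, rfl, by rw [map_one, laurentMonomial_zero]⟩
  | mul s t _ _ hs ht =>
    obtain ⟨e, he, hs⟩ := hs
    obtain ⟨e', he', ht⟩ := ht
    exact ⟨e + e', by simp [he, he'], by rw [map_mul, hs, ht, laurentMonomial_add]⟩

theorem residueForm_of_mem {x : CechTop b P} (hx : x ∈ cechBoundary b P) :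
    residueForm b P x = 0 := by
  suffices h : ∀ f : Poly k V, residueForm b P (f • x) = 0 by
    simpa using h 1
  induction hx using Submodule.span_induction with
  | mem x hx =>
    obtain ⟨i, s, hs, ω, h⟩ := hx
    obtain ⟨e, he, hs⟩ := exists_expand_of_mem b P hs
    intro f
    have h2 : laurentMonomial b P e * laurentForm b P (f • x) =
        expand b P (f * formCoeff b ω) := by
      rw [← hs, ← smul_laurent, ← map_smul, smul_comm, map_smul, h, laurentForm_mkLinearMap,
        smul_laurent, map_mul]
    change laurentCoeff b P _ (laurentForm b P (f • x)) = 0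
    rw [← laurentCoeff_monomial_mul b P _ e, h2]
    exact laurentCoeff_expand b P _ _ (i := i) (by simp [he])
  | zero => simp
  | add x y _ _ hx hy => intro f; rw [smul_add, map_add, hx, hy, add_zero]
  | smul g x _ hx => intro f; rw [smul_smul]; exact hx _

/-- The residue map `Res_P`. -/
def residue : LocalCoh b P →ₗ[k] k :=
  ((cechBoundary b P).restrictScalars k).liftQ (residueForm b P)
      (fun _ hx => residueForm_of_mem b P hx) ∘ₗ
    (Submodule.Quotient.restrictScalarsEquiv k (cechBoundary b P)).symm.toLinearMap

theorem residue_toLocalCoh (x : CechTop b P) :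
    residue b P (toLocalCoh b P x) = residueForm b P x := rfl

theorem residue_localMonomial_smul (a c : Fin n → ℕ) :
    residue b P (localMonomial b P c • residueSymbol b P a) = if c = a then 1 else 0 := by
  set x : CechTop b P := LocalizedModule.mk (volForm b P)
    (⟨localMonomial b P _, localMonomial_mem b P (fun i => a i + 1)⟩ : denominators b P)
  have h : residueSymbol b P a = toLocalCoh b P x := rfl
  have hx := expand_mul_laurentForm_mk b P (volForm b P)
    (⟨localMonomial b P _, localMonomial_mem b P (fun i => a i + 1)⟩ : denominators b P)
  rw [formCoeff_volForm, map_one, expand_localMonomial] at hx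
  have hx' : laurentForm b P x = laurentMonomial b P (fun i => -((a i : ℤ) + 1)) := by
    have := congrArg (laurentMonomial b P (fun i => -((a i : ℤ) + 1)) * ·) hx
    simp only [mul_one, ← mul_assoc, ← laurentMonomial_add] at this
    rw [← this]
    convert (one_mul _).symm
    rw [← laurentMonomial_zero]
    congr 1
    ext i
    simp
  have h2 : localMonomial b P c • residueSymbol b P a =
      toLocalCoh b P (localMonomial b P c • x) := rfl
  rw [h2, residue_toLocalCoh]
  change laurentCoeff b P _ (laurentForm b P _) = _
  rw [map_smul, hx', smul_laurent, expand_localMonomial, ← laurentMonomial_add,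
    laurentCoeff_monomial]
  congr 1
  simp only [eq_iff_iff, funext_iff, Pi.add_apply]
  exact forall_congr' fun i => by omega

theorem kaehler_eq (m : KaehlerDifferential k (Poly k V)) :
    m = ∑ j, (partialDeriv k (b j)).liftKaehlerDifferential m •
      KaehlerDifferential.D k (Poly k V) (localCoord b P j) := by
  have h : (LinearMap.id : KaehlerDifferential k (Poly k V) →ₗ[Poly k V] _) =
      ∑ j, ((partialDeriv k (b j)).liftKaehlerDifferential).smulRight
        (KaehlerDifferential.D k (Poly k V) (localCoord b P j)) := by
    apply Derivation.liftKaehlerDifferential_unique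
    apply Derivation.ext_of_adjoin_eq_top _ adjoin_linForm
    rintro _ ⟨ξ, rfl⟩
    rw [linForm_eq b P]
    simp only [map_add, map_sum, Derivation.map_algebraMap, zero_add]
    refine Finset.sum_congr rfl fun j _ => ?_
    rw [Derivation.map_smul, Derivation.map_smul]
    simp [Derivation.liftKaehlerDifferential_comp_D, partialDeriv_localCoord]
  have := congr($h m)
  simpa using this

/-- The basis `dz_1, …, dz_n` of the Kähler differentials. -/
def kaehlerBasis : Module.Basis (Fin n) (Poly k V) (KaehlerDifferential k (Poly k V)) :=
  Module.Basis.ofEquivFun (LinearEquiv.ofLinearMap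
    (LinearMap.pi fun j => (partialDeriv k (b j)).liftKaehlerDifferential)
    (Fintype.linearCombination (Poly k V)
      fun j => KaehlerDifferential.D k (Poly k V) (localCoord b P j))
    (by
      ext i j
      simp [Fintype.linearCombination_apply, partialDeriv_localCoord, Pi.single_apply, eq_comm])
    (by
      refine LinearMap.ext fun m => ?_
      simp only [LinearMap.comp_apply, Fintype.linearCombination_apply, LinearMap.pi_apply,
        LinearMap.id_apply]
      exact (kaehler_eq b P m).symm))

theorem kaehlerBasis_apply (j : Fin n) :
    kaehlerBasis b P j = KaehlerDifferential.D k (Poly k V) (localCoord b P j) := by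
  simp [kaehlerBasis, Fintype.linearCombination_apply, Pi.single_apply]

theorem eq_formCoeff_smul_volForm (ω : TopForms k V n) :
    ω = formCoeff b ω • volForm b P := by
  have h : (LinearMap.id : TopForms k V n →ₗ[Poly k V] TopForms k V n) =
      (formCoeff b).smulRight (volForm b P) := by
    apply exteriorPower.linearMap_ext
    apply (kaehlerBasis b P).ext_alternating
    intro v hv
    have hv' : Function.Bijective v := Finite.injective_iff_bijective.1 hv
    obtain ⟨σ, rfl⟩ : ∃ σ : Equiv.Perm (Fin n), v = σ := ⟨Equiv.ofBijective v hv', rfl⟩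
    have key : ∀ f : AlternatingMap (Poly k V) (KaehlerDifferential k (Poly k V))
        (TopForms k V n) (Fin n), f (fun i => kaehlerBasis b P (σ i)) =
          Equiv.Perm.sign σ • f (kaehlerBasis b P) := fun f => f.map_perm _ σ
    rw [key, key]
    congr 1
    have h2 : (kaehlerBasis b P : Fin n → _) =
      fun j => KaehlerDifferential.D k (Poly k V) (localCoord b P j) :=
      funext (kaehlerBasis_apply b P)
    rw [h2]
    change volForm b P = formCoeff b (volForm b P) • volForm b P
    rw [formCoeff_volForm, one_smul]
  exact congr($h ω)

/-- Every local cohomology class is a combination of the basic generalised fractions. -/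
theorem span_residueSymbol : Submodule.span k (Set.range (residueSymbol b P)) = ⊤ := by
  rw [eq_top_iff]
  rintro η -
  obtain ⟨x, rfl⟩ := toLocalCoh_surjective b P η
  induction x using LocalizedModule.induction_on with
  | _ ω s =>
  obtain ⟨s, hs⟩ := s
  obtain ⟨c, rfl⟩ := mem_denominators b P hs
  change genFrac b P ω c ∈ _
  rw [eq_formCoeff_smul_volForm b P ω, genFrac_smul]
  generalize formCoeff b ω = f
  have hf : f ∈ Submodule.span k (Set.range (localMonomial b P)) := by
    rw [span_localMonomial]; trivial
  induction hf using Submodule.span_induction with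
  | mem f hf =>
    obtain ⟨a, rfl⟩ := hf
    rw [← genFrac_smul, genFrac]
    by_cases h : ∃ i, c i ≤ a i
    · obtain ⟨i, hi⟩ := h
      rw [(toLocalCoh_eq_zero b P).2]
      · exact Submodule.zero_mem _
      apply Submodule.subset_span
      refine ⟨i, ∏ j ∈ Finset.univ.erase i, localCoord b P j ^ c j, ?_,
        localMonomial b P (a - Pi.single i (c i)) • volForm b P, ?_⟩
      · refine Submonoid.prod_mem _ fun j hj => Submonoid.pow_mem _ (Submonoid.subset_closure
          (Set.mem_image_of_mem _ ?_)) _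
        simpa using hj
      · rw [LocalizedModule.smul'_mk, LocalizedModule.mkLinearMap_apply, LocalizedModule.mk_eq]
        refine ⟨1, ?_⟩
        simp only [one_smul, Submonoid.smul_def, smul_smul]
        congr 1
        have h1 : localMonomial b P a = localMonomial b P (a - Pi.single i (c i)) *
            localCoord b P i ^ c i := by
          rw [← localMonomial_single, ← localMonomial_add]
          congr 1
          ext j
          by_cases hj : j = i
          · subst hj; simp; omega
          · simp [hj]
        have h2 : localMonomial b P c = localCoord b P i ^ c i *
            ∏ j ∈ Finset.univ.erase i, localCoord b P j ^ c j := by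
          exact (Finset.mul_prod_erase Finset.univ (fun j => localCoord b P j ^ c j)
            (Finset.mem_univ i)).symm
        rw [h1, h2]
        ring
    · push Not at h
      apply Submodule.subset_span
      refine ⟨fun i => c i - a i - 1, ?_⟩
      rw [residueSymbol, genFrac]
      congr 1
      rw [LocalizedModule.mk_eq]
      refine ⟨1, ?_⟩
      simp only [one_smul, Submonoid.smul_def, smul_smul]
      rw [← localMonomial_add]
      congr 2
      ext i
      have := h i
      simp only [Pi.add_apply]
      omega
  | zero => rw [zero_smul]; exact Submodule.zero_mem _
  | add f g _ _ hf hg => rw [add_smul]; exact Submodule.add_mem _ hf hg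
  | smul r f _ hf => rw [smul_assoc]; exact Submodule.smul_mem _ r hf

theorem linearIndependent_residueSymbol : LinearIndependent k (residueSymbol b P) := by
  rw [linearIndependent_iff']
  intro s g hg a ha
  have h := congrArg (fun η => residue b P (localMonomial b P a • η)) hg
  simp only [Finset.smul_sum, map_sum, smul_comm (localMonomial b P a), map_smul,
    residue_localMonomial_smul, smul_zero, map_zero] at h
  simpa [ha] using h

/-- The basis of local cohomology given by the generalised fractions
`[dz / z_1^{a_1+1}, …, z_n^{a_n+1}]`. -/
def residueBasis : Module.Basis (Fin n → ℕ) k (LocalCoh b P) :=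
  Module.Basis.mk (linearIndependent_residueSymbol b P) (span_residueSymbol b P).ge

theorem residueBasis_apply (a : Fin n → ℕ) : residueBasis b P a = residueSymbol b P a := by
  simp [residueBasis]

theorem residueBasis_repr (η : LocalCoh b P) (a : Fin n → ℕ) :
    (residueBasis b P).repr η a = residue b P (localMonomial b P a • η) := by
  have h : (Finsupp.lapply a : ((Fin n → ℕ) →₀ k) →ₗ[k] k) ∘ₗ
      (residueBasis b P).repr.toLinearMap =
      residue b P ∘ₗ (LinearMap.lsmul (Poly k V) (LocalCoh b P)
        (localMonomial b P a)).restrictScalars k := by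
    apply (residueBasis b P).ext
    intro c
    simp only [LinearMap.comp_apply, LinearEquiv.coe_coe, Module.Basis.repr_self,
      Finsupp.lapply_apply, Finsupp.single_apply, LinearMap.coe_restrictScalars,
      LinearMap.lsmul_apply]
    rw [residueBasis_apply, residue_localMonomial_smul]
    simp only [eq_comm]
  exact congr($h η)

theorem eq_zero_of_residue {η : LocalCoh b P}
    (h : ∀ a, residue b P (localMonomial b P a • η) = 0) : η = 0 := by
  apply (residueBasis b P).repr.injective
  ext a
  rw [residueBasis_repr, h, map_zero, Finsupp.zero_apply]

/-- The continuous functionals: those `μ : R → k` that vanish on a power of `m_P`. -/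
def contDual : Submodule k (Module.Dual k (Poly k V)) where
  carrier := {μ | ∃ N : ℕ, ∀ f ∈ maxIdeal b P ^ N, μ f = 0}
  zero_mem' := ⟨0, fun _ _ => rfl⟩
  add_mem' := by
    rintro μ μ' ⟨N, h⟩ ⟨N', h'⟩
    refine ⟨max N N', fun f hf => ?_⟩
    rw [LinearMap.add_apply, h f (Ideal.pow_le_pow_right (le_max_left _ _) hf),
      h' f (Ideal.pow_le_pow_right (le_max_right _ _) hf), add_zero]
  smul_mem' := by
    rintro c μ ⟨N, h⟩
    exact ⟨N, fun f hf => by rw [LinearMap.smul_apply, h f hf, smul_zero]⟩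

/-- The functional `f ↦ Res_P(f η)` on `R`. -/
def residuePairing : LocalCoh b P →ₗ[k] Module.Dual k (Poly k V) where
  toFun η := residue b P ∘ₗ (LinearMap.toSpanSingleton (Poly k V) (LocalCoh b P) η).restrictScalars k
  map_add' η η' := by ext f; simp
  map_smul' c η := by ext f; simp [smul_comm f c]

theorem residuePairing_apply (η : LocalCoh b P) (f : Poly k V) :
    residuePairing b P η f = residue b P (f • η) := rfl

theorem localCoord_pow_smul {i : Fin n} {a : Fin n → ℕ} {m : ℕ} (h : a i < m) :
    localCoord b P i ^ m • residueSymbol b P a = 0 := by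
  apply eq_zero_of_residue
  intro c
  rw [smul_smul, ← localMonomial_single, ← localMonomial_add, residue_localMonomial_smul, if_neg]
  rintro rfl
  simp at h

theorem residuePairing_mem (η : LocalCoh b P) : residuePairing b P η ∈ contDual b P := by
  have hη : η ∈ Submodule.span k (Set.range (residueSymbol b P)) := by
    rw [span_residueSymbol]; trivial
  induction hη using Submodule.span_induction with
  | mem η h =>
    obtain ⟨a, rfl⟩ := h
    have hle : maxIdeal b P ≤
        Ideal.radical (LinearMap.ker (LinearMap.toSpanSingleton (Poly k V) (LocalCoh b P)
          (residueSymbol b P a))) := by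
      rw [maxIdeal, Ideal.span_le]
      rintro _ ⟨i, rfl⟩
      refine ⟨a i + 1, ?_⟩
      rw [LinearMap.mem_ker, LinearMap.toSpanSingleton_apply]
      exact localCoord_pow_smul b P (Nat.lt_succ_self _)
    obtain ⟨N, hN⟩ := Ideal.exists_pow_le_of_le_radical_of_fg hle
      ((Submodule.fg_def).2 ⟨_, Set.finite_range _, rfl⟩)
    refine ⟨N, fun f hf => ?_⟩
    have := hN hf
    rw [LinearMap.mem_ker, LinearMap.toSpanSingleton_apply] at this
    rw [residuePairing_apply, this, map_zero]
  | zero => rw [map_zero]; exact Submodule.zero_mem _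
  | add η η' _ _ h h' => rw [map_add]; exact Submodule.add_mem _ h h'
  | smul c η _ h => rw [map_smul]; exact Submodule.smul_mem _ c h

theorem localDuality_bijective :
    Function.Bijective ((residuePairing b P).codRestrict _ (residuePairing_mem b P)) := by
  constructor
  · rw [injective_iff_map_eq_zero]
    intro η h
    apply eq_zero_of_residue
    intro a
    have := congrArg (fun μ : contDual b P => (μ : Module.Dual k (Poly k V)) (localMonomial b P a)) h
    exact this
  · rintro ⟨μ, N, hN⟩
    refine ⟨∑ a ∈ Fintype.piFinset (fun _ : Fin n => Finset.range N),
      μ (localMonomial b P a) • residueSymbol b P a, Subtype.ext ?_⟩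
    apply LinearMap.ext_on_range (span_localMonomial b P)
    intro c
    rw [LinearMap.codRestrict_apply, residuePairing_apply]
    simp only [Finset.smul_sum, map_sum, smul_comm (localMonomial b P c), map_smul,
      residue_localMonomial_smul]
    by_cases hc : ∀ i, c i < N
    · rw [Finset.sum_eq_single c]
      · simp
      · intro a _ hac; simp [Ne.symm hac]
      · intro h; exact absurd (by simpa using hc) h
    · rw [hN]
      · refine Finset.sum_eq_zero fun a ha => ?_
        rw [if_neg, smul_zero]
        rintro rfl
        exact hc (by simpa using ha)
      · push Not at hc
        obtain ⟨i, hi⟩ := hc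
        have h1 : localCoord b P i ^ c i ∈ maxIdeal b P ^ N :=
          Ideal.pow_le_pow_right hi (Ideal.pow_mem_pow (Ideal.subset_span (Set.mem_range_self i)) _)
        have h2 := Finset.mul_prod_erase Finset.univ (fun j => localCoord b P j ^ c j)
            (Finset.mem_univ i)
        rw [localMonomial, ← h2]
        exact Ideal.mul_mem_right _ _ h1

/-- Local duality: `η ↦ Res_P((-) η)` identifies local cohomology with the continuous dual. -/
def localDuality : LocalCoh b P ≃ₗ[k] contDual b P :=
  LinearEquiv.ofBijective _ (localDuality_bijective b P)

theorem localDuality_apply (η : LocalCoh b P) (f : Poly k V) :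
    (localDuality b P η : Module.Dual k (Poly k V)) f = residue b P (f • η) := rfl

theorem derivation_mem (D : Derivation k (Poly k V) (Poly k V)) (N : ℕ) {f : Poly k V}
    (hf : f ∈ maxIdeal b P ^ (N + 1)) : D f ∈ maxIdeal b P ^ N := by
  induction N generalizing f with
  | zero => rw [pow_zero, Ideal.one_eq_top]; trivial
  | succ N ih =>
    rw [pow_succ'] at hf
    refine Submodule.mul_induction_on hf ?_ ?_
    · intro g hg h hh
      rw [Derivation.leibniz]
      refine Ideal.add_mem _ ?_ (Ideal.mul_mem_right _ _ hh)
      rw [pow_succ']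
      exact Ideal.mul_mem_mul hg (ih hh)
    · intro f g hf hg
      rw [map_add]
      exact Ideal.add_mem _ hf hg

theorem diffOp_mem (t : SymmetricAlgebra k V) :
    ∃ d : ℕ, ∀ N : ℕ, ∀ f ∈ maxIdeal b P ^ (N + d), diffOp k V t f ∈ maxIdeal b P ^ N := by
  induction t using SymmetricAlgebra.induction with
  | algebraMap r =>
    refine ⟨0, fun N f hf => ?_⟩
    rw [AlgHom.commutes, Module.algebraMap_end_apply]
    exact Submodule.smul_of_tower_mem _ r hf
  | ι v =>
    refine ⟨1, fun N f hf => ?_⟩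
    rw [diffOp_ι]
    exact derivation_mem b P _ N hf
  | mul s t hs ht =>
    obtain ⟨d, hs⟩ := hs
    obtain ⟨d', ht⟩ := ht
    refine ⟨d + d', fun N f hf => ?_⟩
    rw [map_mul, Module.End.mul_apply]
    exact hs N _ (ht _ f (by rwa [add_assoc]))
  | add s t hs ht =>
    obtain ⟨d, hs⟩ := hs
    obtain ⟨d', ht⟩ := ht
    refine ⟨d + d', fun N f hf => ?_⟩
    rw [map_add, LinearMap.add_apply]
    exact Ideal.add_mem _ (hs N f (Ideal.pow_le_pow_right (by omega) hf))
      (ht N f (Ideal.pow_le_pow_right (by omega) hf))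

/-- The action on continuous functionals of a constant-coefficient differential operator, by
precomposition. -/
def diffActDual (t : SymmetricAlgebra k V) : contDual b P →ₗ[k] contDual b P :=
  ((LinearMap.lcomp k k (diffOp k V t)) ∘ₗ (contDual b P).subtype).codRestrict _ (by
    rintro ⟨μ, N, hN⟩
    obtain ⟨d, hd⟩ := diffOp_mem b P t
    exact ⟨N + d, fun f hf => hN _ (hd N f hf)⟩)

/-- The action of `Sym(V)` on local cohomology through differential operators: the action on
continuous functionals, transported by local duality. -/
def diffAct (t : SymmetricAlgebra k V) : LocalCoh b P →ₗ[k] LocalCoh b P :=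
  (localDuality b P).symm.toLinearMap ∘ₗ diffActDual b P t ∘ₗ (localDuality b P).toLinearMap

theorem residue_smul_diffAct (t : SymmetricAlgebra k V) (η : LocalCoh b P) (f : Poly k V) :
    residue b P (f • diffAct b P t η) = residue b P (diffOp k V t f • η) := by
  rw [← localDuality_apply, ← localDuality_apply, diffAct]
  simp only [LinearMap.comp_apply, LinearEquiv.coe_coe, LinearEquiv.apply_symm_apply]
  rfl

/-- The comultiplication dual to the multiplication of `R`:
`[dz / z^{a+1}] ↦ ∑_{c ≤ a} [dz / z^{c+1}] ⊗ [dz / z^{a-c+1}]`. -/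
def comulHom : LocalCoh b P →ₗ[k] LocalCoh b P ⊗[k] LocalCoh b P :=
  (residueBasis b P).constr k fun a =>
    ∑ c ∈ Finset.Iic a, residueSymbol b P c ⊗ₜ[k] residueSymbol b P (a - c)

theorem comulHom_residueSymbol (a : Fin n → ℕ) :
    comulHom b P (residueSymbol b P a) =
      ∑ c ∈ Finset.Iic a, residueSymbol b P c ⊗ₜ[k] residueSymbol b P (a - c) := by
  rw [comulHom, ← residueBasis_apply, Module.Basis.constr_basis]

theorem residue_residueSymbol (a : Fin n → ℕ) :
    residue b P (residueSymbol b P a) = if a = 0 then 1 else 0 := by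
  have := residue_localMonomial_smul b P a 0
  rw [localMonomial_zero, one_smul] at this
  rw [this]
  simp only [eq_comm]

instance : Coalgebra k (LocalCoh b P) where
  comul := comulHom b P
  counit := residue b P
  coassoc := by
    apply (residueBasis b P).ext
    intro a
    simp only [LinearMap.comp_apply, LinearEquiv.coe_coe, residueBasis_apply,
      comulHom_residueSymbol, map_sum, LinearMap.rTensor_tmul, LinearMap.lTensor_tmul,
      TensorProduct.sum_tmul, TensorProduct.tmul_sum, TensorProduct.assoc_tmul,
      Finset.sum_sigma']
    refine Finset.sum_nbij' (fun x => ⟨x.2, x.1 - x.2⟩) (fun x => ⟨x.1 + x.2, x.1⟩)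
      ?_ ?_ ?_ ?_ ?_
    · rintro ⟨c, d⟩ h
      simp only [Finset.mem_sigma, Finset.mem_Iic] at h ⊢
      exact ⟨h.2.trans h.1, tsub_le_tsub_right h.1 _⟩
    · rintro ⟨c, d⟩ h
      simp only [Finset.mem_sigma, Finset.mem_Iic] at h ⊢
      refine ⟨?_, le_self_add⟩
      rw [add_comm]
      exact (le_tsub_iff_right h.1).1 h.2
    · rintro ⟨c, d⟩ h
      simp only [Finset.mem_sigma, Finset.mem_Iic] at h ⊢
      simp [add_tsub_cancel_of_le h.2]
    · rintro ⟨c, d⟩ h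
      simp
    · rintro ⟨c, d⟩ h
      simp only [Finset.mem_sigma, Finset.mem_Iic] at h ⊢
      rw [tsub_tsub, add_tsub_cancel_of_le h.2]
  rTensor_counit_comp_comul := by
    apply (residueBasis b P).ext
    intro a
    simp only [LinearMap.comp_apply, residueBasis_apply, comulHom_residueSymbol, map_sum,
      LinearMap.rTensor_tmul, residue_residueSymbol, TensorProduct.mk_apply]
    rw [Finset.sum_eq_single 0]
    · simp
    · intro c _ hc; simp [hc]
    · intro h; exact absurd (Finset.mem_Iic.2 zero_le) h
  lTensor_counit_comp_comul := by
    apply (residueBasis b P).ext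
    intro a
    simp only [LinearMap.comp_apply, residueBasis_apply, comulHom_residueSymbol, map_sum,
      LinearMap.lTensor_tmul, residue_residueSymbol, LinearMap.flip_apply, TensorProduct.mk_apply]
    rw [Finset.sum_eq_single a]
    · simp
    · intro c hc hca
      rw [if_neg, TensorProduct.tmul_zero]
      intro h
      exact hca (le_antisymm (Finset.mem_Iic.1 hc) (tsub_eq_zero_iff_le.1 h))
    · intro h; exact absurd (Finset.mem_Iic.2 le_rfl) h

theorem comul_residueSymbol (a : Fin n → ℕ) :
    Coalgebra.comul (R := k) (residueSymbol b P a) =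
      ∑ c ∈ Finset.Iic a, residueSymbol b P c ⊗ₜ[k] residueSymbol b P (a - c) :=
  comulHom_residueSymbol b P a

theorem counit_eq_residue (η : LocalCoh b P) : Coalgebra.counit (R := k) η = residue b P η := rfl

instance : Coalgebra.IsCocomm k (LocalCoh b P) where
  comm_comp_comul := by
    apply (residueBasis b P).ext
    intro a
    simp only [LinearMap.comp_apply, LinearEquiv.coe_coe, residueBasis_apply, comul_residueSymbol,
      map_sum, TensorProduct.comm_tmul]
    refine Finset.sum_nbij' (fun c => a - c) (fun c => a - c) ?_ ?_ ?_ ?_ ?_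
    · intro c _; exact Finset.mem_Iic.2 tsub_le_self
    · intro c _; exact Finset.mem_Iic.2 tsub_le_self
    · intro c hc; exact tsub_tsub_cancel_of_le (Finset.mem_Iic.1 hc)
    · intro c hc; exact tsub_tsub_cancel_of_le (Finset.mem_Iic.1 hc)
    · intro c hc; rw [tsub_tsub_cancel_of_le (Finset.mem_Iic.1 hc)]

/-- The comultiplication is dual, under local duality, to the multiplication of `R`. -/
theorem residuePairing_comul (f g : Poly k V) (η : LocalCoh b P) :
    LinearMap.mul' k k (TensorProduct.map
      ((residuePairing b P).flip f) ((residuePairing b P).flip g) (Coalgebra.comul η)) =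
      residue b P ((f * g) • η) := by
  have hf : f ∈ Submodule.span k (Set.range (localMonomial b P)) := by
    rw [span_localMonomial]; trivial
  have hg : g ∈ Submodule.span k (Set.range (localMonomial b P)) := by
    rw [span_localMonomial]; trivial
  have hη : η ∈ Submodule.span k (Set.range (residueSymbol b P)) := by
    rw [span_residueSymbol]; trivial
  induction hη using Submodule.span_induction with
  | mem η h =>
    obtain ⟨a, rfl⟩ := h
    rw [comul_residueSymbol]
    simp only [map_sum, TensorProduct.map_tmul, LinearMap.flip_apply, residuePairing_apply,
      LinearMap.mul'_apply]
    induction hf using Submodule.span_induction with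
    | mem f hf =>
      obtain ⟨c, rfl⟩ := hf
      induction hg using Submodule.span_induction with
      | mem g hg =>
        obtain ⟨d, rfl⟩ := hg
        simp only [← localMonomial_add, residue_localMonomial_smul]
        by_cases h : c + d = a
        · subst h
          rw [Finset.sum_eq_single c]
          · simp
          · intro e _ he; simp [Ne.symm he]
          · intro h; exact absurd (Finset.mem_Iic.2 le_self_add) h
        · rw [if_neg h]
          refine Finset.sum_eq_zero fun e he => ?_
          by_cases hce : c = e
          · subst hce
            have hd : d ≠ a - c := by
              rintro rfl
              exact h (add_tsub_cancel_of_le (Finset.mem_Iic.1 he))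
            rw [if_neg hd, mul_zero]
          · simp [hce]
      | zero => simp
      | add g g' _ _ h h' => simp only [add_smul, mul_add, map_add, Finset.sum_add_distrib, h, h']
      | smul r g _ h =>
        simp only [mul_smul_comm, smul_assoc, map_smul, smul_eq_mul, ← h, Finset.mul_sum]
        exact Finset.sum_congr rfl fun e _ => by ring
    | zero => simp
    | add f f' _ _ h h' => simp only [add_smul, add_mul, map_add, Finset.sum_add_distrib, h, h']
    | smul r f _ h =>
      simp only [smul_mul_assoc, smul_assoc, map_smul, smul_eq_mul, ← h, Finset.mul_sum]
      exact Finset.sum_congr rfl fun e _ => by ring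
  | zero => simp
  | add η η' _ _ h h' => rw [map_add, map_add, map_add, smul_add, map_add, h, h']
  | smul r η _ h => rw [map_smul, map_smul, map_smul, smul_comm, map_smul, h]

/-- `!V = ⨁_{P ∈ V} H^n_{m_P}(R, Ω^n_{R/k})`. -/
abbrev Bang (b : Module.Basis (Fin n) k V) : Type _ := Π₀ P : V, LocalCoh b P

open scoped Classical in
/-- The direct sum coalgebra; its counit is the sum of the residue maps. -/
instance : Coalgebra k (Bang b) := DFinsupp.instCoalgebra k V (fun P => LocalCoh b P)

open scoped Classical in
instance : Coalgebra.IsCocomm k (Bang b) := DFinsupp.instIsCocomm k V (fun P => LocalCoh b P)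

open scoped Classical in
/-- The inclusion of the summand at `P`. -/
def incl : LocalCoh b P →ₗ[k] Bang b := DFinsupp.lsingle P

/-- The component `d_P(η) = ∑ Res_P(x_i η) e_i` of the dereliction map. -/
def derelictionAt : LocalCoh b P →ₗ[k] V where
  toFun η := ∑ i, residue b P (linForm (b.coord i) • η) • b i
  map_add' η η' := by simp only [smul_add, map_add, add_smul, Finset.sum_add_distrib]
  map_smul' c η := by
    simp only [smul_comm _ c η, map_smul, smul_assoc, RingHom.id_apply, Finset.smul_sum]

open scoped Classical in
/-- The dereliction map `d : !V → V`. -/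
def dereliction : Bang b →ₗ[k] V := DFinsupp.lsum ℕ (fun P => derelictionAt b P)

/-- The ket `|ν_{i_1}, …, ν_{i_r}⟩_P = ∂_{ν_{i_1}} ⋯ ∂_{ν_{i_r}} |0⟩_P` in `!V`, where
`I = {i_1, …, i_r}`. -/
def ket {σ : Type*} (I : Finset σ) (ν : σ → V) : Bang b :=
  incl b P (diffAct b P (∏ i ∈ I, SymmetricAlgebra.ι k V (ν i)) (vacuum b P))

end Setup
end CofreeCoalgebra

end

open CofreeCoalgebra

namespace CofreeCoalgebra

open scoped TensorProduct
open WithConv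

/-! ### Polynomial functions as functionals on `!V` -/

section Pairing

variable {k : Type*} [Field k] {V : Type*} [AddCommGroup V] [Module k V] {n : ℕ}
variable (b : Module.Basis (Fin n) k V) (P : V)

/-! The functionals on `!W` form an algebra under convolution, commutative because `!W` is
cocommutative. Pairing by residues gives an algebra map from `R = Sym(V*)` to the convolution
algebra of `!V` (`pairingHom`), since the coproduct is dual to multiplication. It sends a linear
form `ξ` to `ξ ∘ d` (`evalBang_linForm`).

Uniqueness. A coalgebra morphism `Ψ : !W → !V` therefore pulls polynomial functions back by an
algebra map from `R` to functionals on `!W`. If `d ∘ Ψ = φ`, this map sends `ξ` to `ξ ∘ φ`. As `R`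
is free on `V*`, it must be `dualLift`. Polynomial functions separate the points of `!V`
(`eq_zero_of_evalBang`, by coprimality of powers of distinct `m_P`), so `Ψ` is determined.

Existence. By local duality, it suffices that for each class `η` at `P` the functional `f ↦
(dualLift f)(η)` vanishes on a power of `m_Q`, where `Q = φ|0⟩_P`. The vacuum is grouplike, so on it
`dualLift` is evaluation at `Q`. A coproduct distributes the finite pole order of `η` among its
factors. When there are more elements of `m_Q` than the total order, some factor is the vacuum and
contributes zero (`dualLift_residueSymbol_eq_zero`). The resulting linear map respects coproducts
because `dualLift` is multiplicative.

Formula. This is the chain rule of Faà di Bruno, `dualLift_ket`, proved by induction on `f`. For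
constants and linear forms at most one partition contributes. For a product, Leibniz's rule splits
the index set on one side and the set of blocks on the other, and the two splittings match by
`sum_partitionFamilies_powerset`. -/

theorem comul_incl (η : LocalCoh b P) :
    Coalgebra.comul (R := k) (incl b P η) =
      TensorProduct.map (incl b P) (incl b P) (Coalgebra.comul η) := by
  classical
  exact DFinsupp.comul_single k V (fun P => LocalCoh b P) P η

theorem counit_incl (η : LocalCoh b P) :
    Coalgebra.counit (R := k) (incl b P η) = residue b P η := by
  classical
  exact DFinsupp.counit_single k V (fun P => LocalCoh b P) P η

theorem bang_hom_ext {M : Type*} [AddCommMonoid M] [Module k M] {F G : Bang b →ₗ[k] M}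
    (h : ∀ P η, F (incl b P η) = G (incl b P η)) : F = G := by
  classical
  exact DFinsupp.lhom_ext h

theorem convMul_incl (F G : WithConv (Bang b →ₗ[k] k)) (η : LocalCoh b P) :
    (F * G) (incl b P η) = LinearMap.mul' k k (TensorProduct.map (F.ofConv ∘ₗ incl b P)
      (G.ofConv ∘ₗ incl b P) (Coalgebra.comul η)) := by
  rw [LinearMap.convMul_apply, comul_incl, TensorProduct.map_map]

open scoped Classical in
/-- The functional `(η_P)_P ↦ ∑_P Res_P(f η_P)` on `!V`. -/
noncomputable def evalBang (f : Poly k V) : Bang b →ₗ[k] k :=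
  DFinsupp.lsum ℕ fun P => (residuePairing b P).flip f

theorem evalBang_incl (f : Poly k V) (η : LocalCoh b P) :
    evalBang b f (incl b P η) = residue b P (f • η) := by
  classical
  exact (DFinsupp.lsum_single _ _ _ _).trans rfl

/-- The algebra map from `R` to the convolution algebra of functionals on `!V`. -/
noncomputable def pairingHom : Poly k V →ₐ[k] WithConv (Bang b →ₗ[k] k) where
  toFun f := toConv (evalBang b f)
  map_one' := by
    apply ofConv_injective
    refine bang_hom_ext b fun P η => ?_
    rw [ofConv_toConv, evalBang_incl, one_smul]
    exact (counit_incl b P η).symm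
  map_zero' := by
    apply ofConv_injective
    refine bang_hom_ext b fun P η => ?_
    rw [ofConv_toConv, evalBang_incl, zero_smul, map_zero]
    rfl
  map_add' f g := by
    apply ofConv_injective
    refine bang_hom_ext b fun P η => ?_
    rw [ofConv_toConv, evalBang_incl, add_smul, map_add, ← evalBang_incl, ← evalBang_incl]
    rfl
  map_mul' f g := by
    apply ofConv_injective
    refine bang_hom_ext b fun P η => ?_
    -- Convolution is defined through the coproduct, which on each summand is dual to the
    -- multiplication of `R`.
    rw [ofConv_toConv, evalBang_incl, ← residuePairing_comul]
    refine Eq.trans ?_ (convMul_incl b P (toConv (evalBang b f)) (toConv (evalBang b g)) η).symm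
    congr 2
    congr 1
    all_goals
      ext η
      exact (evalBang_incl b P _ η).symm
  commutes' r := by
    apply ofConv_injective
    refine bang_hom_ext b fun P η => ?_
    rw [ofConv_toConv, evalBang_incl, algebraMap_smul, map_smul]
    exact congrArg (r • ·) (counit_incl b P η).symm

theorem pairingHom_apply (f : Poly k V) (x : Bang b) : pairingHom b f x = evalBang b f x := rfl

theorem residue_smul_vacuum_linForm (ξ : Module.Dual k V) :
    residue b P (linForm ξ • vacuum b P) = ξ P := by
  rw [linForm_eq b P, add_smul, map_add, algebraMap_smul, map_smul, vacuum,
    residue_residueSymbol, if_pos rfl, Finset.sum_smul, map_sum, Finset.sum_eq_zero]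
  · simp
  · intro i _
    rw [smul_assoc, map_smul]
    have := localCoord_pow_smul b P (i := i) (a := 0) (m := 1) (by simp)
    rw [pow_one] at this
    rw [this, map_zero, smul_zero]

/-- This turns the condition `d ∘ Φ = φ` into a condition on the pullback of linear forms, that is,
on generators of `R`. -/
theorem evalBang_linForm (ξ : Module.Dual k V) (x : Bang b) :
    evalBang b (linForm ξ) x = ξ (dereliction b x) := by
  classical
  refine congrArg (fun F : Bang b →ₗ[k] k => F x)
    (bang_hom_ext b (F := evalBang b (linForm ξ)) (G := ξ ∘ₗ dereliction b) fun P η => ?_)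
  have h : dereliction b (incl b P η) = derelictionAt b P η := DFinsupp.lsum_single _ _ _ _
  rw [evalBang_incl, LinearMap.comp_apply, h]
  have hξ : ξ = ∑ i, ξ (b i) • b.coord i := by
    apply b.ext
    intro j
    simp
  rw [show linForm ξ = ∑ i, ξ (b i) • (linForm (b.coord i) : Poly k V) by
    conv_lhs => rw [hξ, map_sum]
    simp only [map_smul]]
  simp [derelictionAt, Finset.sum_smul, mul_comm]

theorem vacuum_comul : Coalgebra.comul (R := k) (vacuum b P) = vacuum b P ⊗ₜ[k] vacuum b P := by
  rw [vacuum, comul_residueSymbol]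
  have : Finset.Iic (0 : Fin n → ℕ) = {0} := by
    ext a
    simp only [Finset.mem_Iic, Finset.mem_singleton]
    exact nonpos_iff_eq_zero
  rw [this, Finset.sum_singleton, tsub_zero]

/-- The vacuum is grouplike, so pairing with it is multiplicative: it is evaluation at `P`. -/
theorem residue_mul_smul_vacuum (f g : Poly k V) :
    residue b P ((f * g) • vacuum b P) =
      residue b P (f • vacuum b P) * residue b P (g • vacuum b P) := by
  rw [← residuePairing_comul, vacuum_comul]
  rfl

theorem residue_smul_vacuum_of_mem {f : Poly k V} (hf : f ∈ maxIdeal b P) :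
    residue b P (f • vacuum b P) = 0 := by
  rw [maxIdeal] at hf
  induction hf using Submodule.span_induction with
  | mem f hf =>
    obtain ⟨i, rfl⟩ := hf
    have := localCoord_pow_smul b P (i := i) (a := 0) (m := 1) (by simp)
    rw [pow_one] at this
    rw [vacuum, this, map_zero]
  | zero => rw [zero_smul, map_zero]
  | add f g _ _ hf hg => rw [add_smul, map_add, hf, hg, add_zero]
  | smul r f _ hf => rw [smul_eq_mul, residue_mul_smul_vacuum, hf, mul_zero]

/-- Some coordinate separates `P` from `Q`, and the two local coordinates for it differ by the
nonzero constant `Q_i - P_i`. Dividing by that constant writes `1` as a sum from the two ideals. -/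
theorem isCoprime_maxIdeal {P Q : V} (h : P ≠ Q) : IsCoprime (maxIdeal b P) (maxIdeal b Q) := by
  obtain ⟨i, hi⟩ : ∃ i, b.coord i P ≠ b.coord i Q := by
    by_contra! hc
    exact h (b.ext_elem fun i => hc i)
  have hne : b.coord i Q - b.coord i P ≠ 0 := sub_ne_zero.2 (Ne.symm hi)
  rw [Ideal.isCoprime_iff_exists]
  refine ⟨(b.coord i Q - b.coord i P)⁻¹ • localCoord b P i,
    Submodule.smul_of_tower_mem _ _ (Ideal.subset_span (Set.mem_range_self i)),
    -((b.coord i Q - b.coord i P)⁻¹ • localCoord b Q i),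
    Ideal.neg_mem_iff _ |>.2 <| Submodule.smul_of_tower_mem _ _
      (Ideal.subset_span (Set.mem_range_self i)), ?_⟩
  rw [← sub_eq_add_neg, ← smul_sub, localCoord, localCoord, sub_sub_sub_cancel_left,
    ← map_sub (algebraMap k (Poly k V)), Algebra.smul_def, ← map_mul, inv_mul_cancel₀ hne, map_one]

/-- Polynomial functions separate the points of `!V`. -/
theorem eq_zero_of_evalBang {x : Bang b} (h : ∀ f, evalBang b f x = 0) : x = 0 := by
  classical
  have hx : x = ∑ P ∈ x.support, incl b P (x P) := (DFinsupp.sum_single (f := x)).symm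
  have hev : ∀ f : Poly k V, ∑ P ∈ x.support, residue b P (f • (x P : LocalCoh b P)) = 0 := by
    intro f
    have := h f
    rw [hx, map_sum] at this
    simpa only [evalBang_incl] using this
  have hN : ∀ P, ∃ N : ℕ, ∀ f ∈ maxIdeal b P ^ N, residue b P (f • (x P : LocalCoh b P)) = 0 :=
    fun P => residuePairing_mem b P (x P)
  choose N hN using hN
  ext P : 1
  rw [DFinsupp.zero_apply]
  by_cases hP : P ∈ x.support
  swap
  · simpa using hP
  apply eq_zero_of_residue
  intro a
  generalize localMonomial b P a = f
  -- Chinese remainder argument: the component at `Q` is killed by `m_Q ^ N Q`. Choose `v` congruent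
  -- to `1` modulo `m_P ^ N P` and lying in all the other powers. Pairing with `f * v` then sees
  -- only the component at `P`, where it agrees with pairing with `f`.
  have hco : IsCoprime (maxIdeal b P ^ N P)
      (∏ Q ∈ x.support.erase P, maxIdeal b Q ^ N Q) :=
    IsCoprime.prod_right fun Q hQ =>
      (isCoprime_maxIdeal b (Finset.ne_of_mem_erase hQ).symm).pow
  obtain ⟨u, hu, v, hv, huv⟩ := Ideal.isCoprime_iff_exists.1 hco
  have hvf := hev (f * v)
  rw [Finset.sum_eq_single_of_mem P hP] at hvf
  · have : f = f * u + f * v := by rw [← mul_add, huv, mul_one]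
    rw [this, add_smul, map_add, hN P _ (Ideal.mul_mem_left _ _ hu), hvf, add_zero]
  · intro Q hQ hQP
    exact hN Q _ (Ideal.mul_mem_left _ _
      (Ideal.le_of_dvd (Finset.dvd_prod_of_mem _ (Finset.mem_erase.2 ⟨hQP, hQ⟩)) hv))

theorem evalBang_ext {x y : Bang b} (h : ∀ f, evalBang b f x = evalBang b f y) : x = y :=
  sub_eq_zero.1 (eq_zero_of_evalBang b fun f => by rw [map_sub, h, sub_self])

/-- The coordinates of a tensor in the product of the residue bases are its pairings with pairs of
monomials. Identities between coproducts can thus be tested against pairs of polynomial functions.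
-/
theorem tensor_ext_of_residue {x y : LocalCoh b P ⊗[k] LocalCoh b P}
    (h : ∀ f g : Poly k V,
      LinearMap.mul' k k (TensorProduct.map
        ((residuePairing b P).flip f) ((residuePairing b P).flip g) x) =
      LinearMap.mul' k k (TensorProduct.map
        ((residuePairing b P).flip f) ((residuePairing b P).flip g) y)) : x = y := by
  have key : ∀ (a c : Fin n → ℕ) (z : LocalCoh b P ⊗[k] LocalCoh b P),
      ((residueBasis b P).tensorProduct (residueBasis b P)).repr z (a, c) =
      LinearMap.mul' k k (TensorProduct.map
        ((residuePairing b P).flip (localMonomial b P a))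
        ((residuePairing b P).flip (localMonomial b P c)) z) := by
    intro a c z
    induction z using TensorProduct.induction_on with
    | zero => simp
    | tmul η η' =>
      simp only [Module.Basis.tensorProduct_repr_tmul_apply, residueBasis_repr, smul_eq_mul,
        TensorProduct.map_tmul, LinearMap.flip_apply, residuePairing_apply, LinearMap.mul'_apply]
      ring
    | add z z' hz hz' => simp only [map_add, Finsupp.add_apply, hz, hz']
  refine ((residueBasis b P).tensorProduct (residueBasis b P)).ext_elem ?_
  rintro ⟨a, c⟩
  rw [key, key, h]

theorem ket_empty {σ : Type*} (ν : σ → V) : ket b P (∅ : Finset σ) ν = incl b P (vacuum b P) := by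
  rw [ket, Finset.prod_empty]
  congr 1
  refine sub_eq_zero.1 (eq_zero_of_residue b P fun a => ?_)
  rw [smul_sub, map_sub, residue_smul_diffAct, map_one, Module.End.one_apply, sub_self]

end Pairing

/-! ### Coalgebra morphisms and convolution algebras -/

section Precomposition

variable {k : Type*} [Field k] {C D : Type*} [AddCommGroup C] [Module k C] [Coalgebra k C]
  [AddCommGroup D] [Module k D] [Coalgebra k D]

/-- The map of convolution algebras dual to a morphism of coalgebras. -/
def convPrecomp (Ψ : C →ₗc[k] D) : WithConv (D →ₗ[k] k) →ₐ[k] WithConv (C →ₗ[k] k) where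
  toFun F := toConv (F.ofConv ∘ₗ Ψ.toLinearMap)
  map_one' := by
    apply ofConv_injective
    ext x
    exact CoalgHomClass.counit_comp_apply Ψ x
  map_zero' := rfl
  map_add' F G := rfl
  map_mul' F G := ofConv_injective (LinearMap.convMul_comp_coalgHom_distrib F G Ψ)
  commutes' r := by
    apply ofConv_injective
    ext x
    exact congrArg (r • ·) (CoalgHomClass.counit_comp_apply Ψ x)

end Precomposition

/-! ### Leibniz's rule and the coproduct of kets -/

section Kets

variable {k : Type*} [Field k] {V : Type*} [AddCommGroup V] [Module k V] {n : ℕ}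
variable (b : Module.Basis (Fin n) k V) (P : V) {σ : Type*} [DecidableEq σ] (ν : σ → V)

theorem diffOp_prod_insert {i : σ} {I : Finset σ} (hi : i ∉ I) (f : Poly k V) :
    diffOp k V (∏ j ∈ insert i I, SymmetricAlgebra.ι k V (ν j)) f =
      diffOp k V (∏ j ∈ I, SymmetricAlgebra.ι k V (ν j)) (partialDeriv k (ν i) f) := by
  rw [Finset.prod_insert hi, mul_comm, map_mul, Module.End.mul_apply, diffOp_ι]

/-- The iterated Leibniz rule. -/
theorem diffOp_prod_mul (I : Finset σ) (f g : Poly k V) :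
    diffOp k V (∏ i ∈ I, SymmetricAlgebra.ι k V (ν i)) (f * g) =
      ∑ J ∈ I.powerset, diffOp k V (∏ i ∈ J, SymmetricAlgebra.ι k V (ν i)) f *
        diffOp k V (∏ i ∈ I \ J, SymmetricAlgebra.ι k V (ν i)) g := by
  induction I using Finset.induction_on generalizing f g with
  | empty => simp
  | insert i I hi ih =>
    -- The extra derivative `∂_{ν i}` falls on `g` or on `f`. These two cases are the subsets of
    -- `insert i I` that omit `i` and those that contain it.
    rw [diffOp_prod_insert ν hi, Derivation.leibniz, map_add, smul_eq_mul, smul_eq_mul, ih,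
      mul_comm g, ih, Finset.sum_powerset_insert hi]
    congr 1
    · refine Finset.sum_congr rfl fun J hJ => ?_
      have hiJ : i ∉ J := fun h => hi (Finset.mem_powerset.1 hJ h)
      rw [Finset.insert_sdiff_of_notMem _ hiJ, diffOp_prod_insert ν (by simp [hi])]
    · refine Finset.sum_congr rfl fun J hJ => ?_
      have hiJ : i ∉ J := fun h => hi (Finset.mem_powerset.1 hJ h)
      rw [diffOp_prod_insert ν hiJ, Finset.insert_sdiff_insert, Finset.sdiff_insert_of_notMem hi]

theorem diffOp_prod_algebraMap (I : Finset σ) (r : k) :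
    diffOp k V (∏ i ∈ I, SymmetricAlgebra.ι k V (ν i)) (algebraMap k _ r) =
      if I = ∅ then algebraMap k _ r else 0 := by
  induction I using Finset.induction_on with
  | empty => simp
  | insert i I hi ih =>
    rw [diffOp_prod_insert ν hi, Derivation.map_algebraMap, map_zero, if_neg]
    exact Finset.insert_ne_empty i I

/-- The first derivative of a linear form is constant, and any further one kills it. -/
theorem diffOp_prod_linForm_eq_zero {I : Finset σ} (h : 1 < I.card) (ξ : Module.Dual k V) :
    diffOp k V (∏ i ∈ I, SymmetricAlgebra.ι k V (ν i)) (linForm ξ) = 0 := by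
  obtain ⟨i, hi⟩ : I.Nonempty := Finset.card_pos.1 (by omega)
  rw [← Finset.insert_erase hi, diffOp_prod_insert ν (Finset.notMem_erase i I),
    partialDeriv_linForm, diffOp_prod_algebraMap, if_neg]
  intro he
  have := Finset.card_erase_of_mem hi
  rw [he, Finset.card_empty] at this
  omega

theorem residue_diffOp_prod_mul (I : Finset σ) (f g : Poly k V) :
    residue b P (diffOp k V (∏ i ∈ I, SymmetricAlgebra.ι k V (ν i)) (f * g) • vacuum b P) =
      ∑ J ∈ I.powerset,
        residue b P (diffOp k V (∏ i ∈ J, SymmetricAlgebra.ι k V (ν i)) f • vacuum b P) *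
        residue b P (diffOp k V (∏ i ∈ I \ J, SymmetricAlgebra.ι k V (ν i)) g • vacuum b P) := by
  rw [diffOp_prod_mul, Finset.sum_smul, map_sum]
  simp only [residue_mul_smul_vacuum]

theorem evalBang_incl_diffAct (t : SymmetricAlgebra k V) (f : Poly k V) :
    evalBang b f (incl b P (diffAct b P t (vacuum b P))) =
      residue b P (diffOp k V t f • vacuum b P) := by
  rw [evalBang_incl, residue_smul_diffAct]

/-- Transposed Leibniz rule: against `f ⊗ g`, the left side differentiates `f * g` and evaluates at
`P`. Evaluation is multiplicative, so each Leibniz term becomes a product of two pairings. -/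
theorem comul_ket (I : Finset σ) :
    Coalgebra.comul (R := k) (ket b P I ν) =
      ∑ J ∈ I.powerset, ket b P J ν ⊗ₜ[k] ket b P (I \ J) ν := by
  simp only [ket]
  rw [comul_incl]
  simp only [← TensorProduct.map_tmul]
  rw [← map_sum]
  congr 1
  refine tensor_ext_of_residue b P fun f g => ?_
  rw [residuePairing_comul, residue_smul_diffAct, residue_diffOp_prod_mul]
  simp only [map_sum, TensorProduct.map_tmul, LinearMap.flip_apply, residuePairing_apply,
    LinearMap.mul'_apply, residue_smul_diffAct]

theorem counit_ket (I : Finset σ) :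
    Coalgebra.counit (R := k) (ket b P I ν) = if I = ∅ then 1 else 0 := by
  rw [ket, counit_incl]
  have h := residue_smul_diffAct b P (∏ i ∈ I, SymmetricAlgebra.ι k V (ν i)) (vacuum b P) 1
  rw [one_smul, ← map_one (algebraMap k (Poly k V)), diffOp_prod_algebraMap] at h
  rw [h]
  split_ifs
  · rw [map_one, one_smul, vacuum, residue_residueSymbol, if_pos rfl]
  · rw [zero_smul, map_zero]

end Kets

/-! ### Set partitions and splittings of their blocks -/

section Partitions

variable {ι : Type*} [DecidableEq ι]

/-- The sets of blocks of the partitions of `I`. -/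
def partitionFamilies (I : Finset ι) : Finset (Finset (Finset ι)) :=
  Finset.univ.image (Finpartition.parts (a := I))

/-- The type `Finpartition I` depends on `I`, which is awkward when partitions of `J` and of `I \ J`
are merged. Families of blocks all live in one type, and a partition is determined by its family. -/
theorem sum_partitionFamilies {M : Type*} [AddCommMonoid M] (I : Finset ι)
    (g : Finset (Finset ι) → M) :
    ∑ S ∈ partitionFamilies I, g S = ∑ C : Finpartition I, g C.parts :=
  Finset.sum_image fun _ _ _ _ h => Finpartition.ext h

theorem mem_partitionFamilies {I : Finset ι} {S : Finset (Finset ι)} :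
    S ∈ partitionFamilies I ↔
      (S : Set (Finset ι)).PairwiseDisjoint id ∧ S.sup id = I ∧ ∅ ∉ S := by
  simp only [partitionFamilies, Finset.mem_image, Finset.mem_univ, true_and]
  constructor
  · rintro ⟨C, rfl⟩
    exact ⟨C.disjoint, C.sup_parts, C.bot_notMem⟩
  · rintro ⟨h1, h2, h3⟩
    exact ⟨⟨S, Finset.supIndep_iff_pairwiseDisjoint.2 h1, h2, h3⟩, rfl⟩

/-- The partition with no blocks is what produces `Φ|0⟩_P = |0⟩_Q`. -/
theorem partitionFamilies_empty : partitionFamilies (∅ : Finset ι) = {∅} := by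
  ext S
  rw [mem_partitionFamilies, Finset.mem_singleton]
  constructor
  · rintro ⟨-, h, h'⟩
    by_contra hS
    obtain ⟨B, hB⟩ := Finset.nonempty_iff_ne_empty.2 hS
    have : B ⊆ ∅ := h ▸ Finset.le_sup (f := id) hB
    exact h' (Finset.subset_empty.1 this ▸ hB)
  · rintro rfl
    simp

theorem singleton_mem_partitionFamilies {I : Finset ι} (hI : I ≠ ∅) :
    {I} ∈ partitionFamilies I := by
  rw [mem_partitionFamilies]
  simp [hI.symm]

theorem nonempty_of_mem_partitionFamilies {I : Finset ι} (hI : I ≠ ∅) {S : Finset (Finset ι)}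
    (hS : S ∈ partitionFamilies I) : S ≠ ∅ := by
  rintro rfl
  exact hI (mem_partitionFamilies.1 hS).2.1.symm

/-- Together with `diffOp_prod_linForm_eq_zero`, this removes every partition but the one-block one
when the operators act on a linear form. -/
theorem one_lt_card_of_mem_partitionFamilies {I : Finset ι} (hI : I ≠ ∅) {S : Finset (Finset ι)}
    (hS : S ∈ partitionFamilies I) (h : S ≠ {I}) : 1 < S.card := by
  by_contra hc
  rcases Nat.le_one_iff_eq_zero_or_eq_one.1 (not_lt.1 hc) with h0 | h1
  · exact nonempty_of_mem_partitionFamilies hI hS (Finset.card_eq_zero.1 h0)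
  · obtain ⟨B, rfl⟩ := Finset.card_eq_one.1 h1
    have := (mem_partitionFamilies.1 hS).2.1
    rw [Finset.sup_singleton, id] at this
    exact h (this ▸ rfl)

/-- Splitting the blocks of a partition of `I` into two classes amounts to splitting `I` into two
parts and partitioning each of them. -/
theorem sum_partitionFamilies_powerset {M : Type*} [AddCommMonoid M] (I : Finset ι)
    (g : Finset (Finset ι) → Finset (Finset ι) → M) :
    ∑ S ∈ partitionFamilies I, ∑ D ∈ S.powerset, g D (S \ D) =
      ∑ J ∈ I.powerset, ∑ S ∈ partitionFamilies J, ∑ T ∈ partitionFamilies (I \ J), g S T := by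
  simp only [Finset.sum_sigma']
  -- A chosen set `D` of blocks covers some `J`, and the remaining blocks partition `I \ J`. The
  -- inverse takes the union of the two families.
  refine Finset.sum_nbij' (fun x => ⟨x.2.sup id, ⟨x.2, x.1 \ x.2⟩⟩)
    (fun y => ⟨y.2.1 ∪ y.2.2, y.2.1⟩) ?_ ?_ ?_ ?_ ?_
  · rintro ⟨S, D⟩ h
    simp only [Finset.mem_sigma, Finset.mem_powerset, mem_partitionFamilies] at h ⊢
    obtain ⟨⟨h1, h2, h3⟩, hD⟩ := h
    refine ⟨h2 ▸ Finset.sup_mono hD, ⟨h1.subset (by exact_mod_cast hD), trivial,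
      fun h => h3 (hD h)⟩, h1.subset (by exact_mod_cast Finset.sdiff_subset), ?_,
      fun h => h3 (Finset.sdiff_subset h)⟩
    subst h2
    ext i
    simp only [Finset.mem_sup, Finset.mem_sdiff, id]
    constructor
    · rintro ⟨B, ⟨hB, hBD⟩, hi⟩
      refine ⟨⟨B, hB, hi⟩, ?_⟩
      rintro ⟨B', hB', hi'⟩
      have hne : B ≠ B' := by rintro rfl; exact hBD hB'
      exact Finset.disjoint_left.1 (h1 hB (hD hB') hne) hi hi'
    · rintro ⟨⟨B, hB, hi⟩, hn⟩
      exact ⟨B, ⟨hB, fun hBD => hn ⟨B, hBD, hi⟩⟩, hi⟩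
  · rintro ⟨J, S, T⟩ h
    simp only [Finset.mem_sigma, Finset.mem_powerset, mem_partitionFamilies] at h ⊢
    obtain ⟨hJ, ⟨h1, h2, h3⟩, h1', h2', h3'⟩ := h
    refine ⟨⟨?_, ?_, ?_⟩, Finset.subset_union_left⟩
    · rw [Finset.coe_union, Set.pairwiseDisjoint_union]
      refine ⟨h1, h1', fun B hB B' hB' _ => ?_⟩
      have hB1 : B ⊆ J := h2 ▸ Finset.le_sup (f := id) hB
      have hB2 : B' ⊆ I \ J := h2' ▸ Finset.le_sup (f := id) hB'
      exact Finset.disjoint_of_subset_left hB1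
        (Finset.disjoint_of_subset_right hB2 Finset.disjoint_sdiff)
    · rw [Finset.sup_union, h2, h2']
      exact Finset.union_sdiff_of_subset hJ
    · simp [h3, h3']
  · rintro ⟨S, D⟩ h
    simp only [Finset.mem_sigma, Finset.mem_powerset] at h
    simp [Finset.union_sdiff_of_subset h.2]
  · rintro ⟨J, S, T⟩ h
    simp only [Finset.mem_sigma, Finset.mem_powerset, mem_partitionFamilies] at h
    obtain ⟨hJ, ⟨h1, h2, h3⟩, h1', h2', h3'⟩ := h
    -- A block common to both families would lie in `J` and in `I \ J`, hence be empty, which is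
    -- excluded. So removing `S` from `S ∪ T` gives back `T`.
    have hd : Disjoint S T := by
      rw [Finset.disjoint_left]
      intro B hB hB'
      have hB1 : B ⊆ J := h2 ▸ Finset.le_sup (f := id) hB
      have hB2 : B ⊆ I \ J := h2' ▸ Finset.le_sup (f := id) hB'
      have : B = ∅ := by
        rw [← Finset.subset_empty, ← Finset.inter_sdiff_self J I]
        exact Finset.subset_inter hB1 hB2
      exact h3 (this ▸ hB)
    simp only [h2, Finset.union_sdiff_cancel_left hd]
  · rintro ⟨S, D⟩ _
    rfl

end Partitions

/-! ### Existence and uniqueness of the lift -/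

section Lift

variable {k : Type*} [Field k] {W V : Type*} [AddCommGroup W] [Module k W] [AddCommGroup V]
  [Module k V] {m n : ℕ} (bW : Module.Basis (Fin m) k W) (bV : Module.Basis (Fin n) k V)
  (φ : Bang bW →ₗ[k] V) (P : W)

/-- The algebra map from the polynomial functions on `V` to the convolution algebra of functionals
on `!W`, given on `V*` by precomposition with `φ`. -/
noncomputable def dualLift : Poly k V →ₐ[k] WithConv (Bang bW →ₗ[k] k) :=
  -- The universal property of `Sym(V*)` needs a commutative target; here this is the
  -- cocommutativity of `!W`.
  polyLift
    { toFun := fun ξ => toConv (ξ ∘ₗ φ)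
      map_add' := fun _ _ => rfl
      map_smul' := fun _ _ => rfl }

theorem dualLift_linForm (ξ : Module.Dual k V) (x : Bang bW) :
    dualLift bW φ (linForm ξ) x = ξ (φ x) := by
  rw [dualLift, polyLift_linForm]
  rfl

theorem dualLift_one (x : Bang bW) : dualLift bW φ 1 x = Coalgebra.counit (R := k) x := by
  rw [map_one]
  rfl

/-- Pulling back functionals along a coalgebra morphism lifting `φ` is `dualLift`. -/
theorem evalBang_comp_of_lift {Ψ : Bang bW →ₗc[k] Bang bV}
    (hΨ : dereliction bV ∘ₗ Ψ.toLinearMap = φ) (f : Poly k V) (x : Bang bW) :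
    evalBang bV f (Ψ x) = dualLift bW φ f x := by
  -- Both sides are algebra maps out of `R`, so it is enough to compare them on linear forms, where
  -- the hypothesis on `Ψ` applies.
  have h : (convPrecomp Ψ).comp (pairingHom bV) = dualLift bW φ := by
    apply AlgHom.ext_of_adjoin_eq_top adjoin_linForm
    rintro _ ⟨ξ, rfl⟩
    apply ofConv_injective
    refine LinearMap.ext fun x => ?_
    refine Eq.trans ?_ (dualLift_linForm bW φ ξ x).symm
    rw [← hΨ]
    exact evalBang_linForm bV ξ (Ψ x)
  rw [← h]
  rfl

theorem dualLift_mul_incl (f g : Poly k V) (η : LocalCoh bW P) :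
    dualLift bW φ (f * g) (incl bW P η) = LinearMap.mul' k k
      (TensorProduct.map ((dualLift bW φ f).ofConv ∘ₗ incl bW P)
        ((dualLift bW φ g).ofConv ∘ₗ incl bW P) (Coalgebra.comul η)) := by
  rw [map_mul, convMul_incl]

/-- On the vacuum at `P`, `dualLift` is evaluation at `φ|0⟩_P`. -/
theorem dualLift_vacuum {Q : V} (hQ : Q = φ (incl bW P (vacuum bW P))) (f : Poly k V) :
    dualLift bW φ f (incl bW P (vacuum bW P)) = residue bV Q (f • vacuum bV Q) := by
  induction f using poly_induction with
  | algebraMap r =>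
    rw [AlgHom.commutes, algebraMap_smul, map_smul, vacuum, vacuum, residue_residueSymbol,
      if_pos rfl, LinearMap.convAlgebraMap_apply, counit_incl, residue_residueSymbol, if_pos rfl]
    simp
  | linForm ξ => rw [dualLift_linForm, ← hQ, residue_smul_vacuum_linForm]
  | mul f g hf hg =>
    rw [dualLift_mul_incl, vacuum_comul, residue_mul_smul_vacuum, ← hf, ← hg]
    rfl
  | add f g hf hg =>
    rw [map_add, add_smul, map_add, ← hf, ← hg]
    rfl

/-- Each factor from `m_Q` must absorb at least one unit of the order `∑ a_i`, since on the vacuum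
it evaluates to zero. With `N` factors and order below `N` this is impossible. -/
theorem dualLift_residueSymbol_eq_zero {Q : V} (hQ : Q = φ (incl bW P (vacuum bW P))) (N : ℕ)
    (f : Poly k V) (hf : f ∈ maxIdeal bV Q ^ N) (a : Fin m → ℕ) (ha : ∑ i, a i < N) :
    dualLift bW φ f (incl bW P (residueSymbol bW P a)) = 0 := by
  induction N generalizing f a with
  | zero => omega
  | succ N ih =>
    rw [pow_succ'] at hf
    refine Submodule.mul_induction_on hf ?_ ?_
    · intro g hg h hh
      rw [dualLift_mul_incl, comul_residueSymbol, map_sum, map_sum]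
      refine Finset.sum_eq_zero fun c hc => ?_
      rw [TensorProduct.map_tmul, LinearMap.mul'_apply]
      -- If `c = 0`, the factor `g` in `m_Q` is paired with the vacuum and evaluates to zero at `Q`.
      -- Otherwise `a - c` has strictly smaller order and the induction hypothesis applies to `h`.
      by_cases h0 : c = 0
      · subst h0
        have : dualLift bW φ g (incl bW P (vacuum bW P)) = 0 := by
          rw [dualLift_vacuum bW bV φ P hQ, residue_smul_vacuum_of_mem bV Q hg]
        exact mul_eq_zero_of_left this _
      · refine mul_eq_zero_of_right _ (ih h hh (a - c) ?_)
        have hca := Finset.mem_Iic.1 hc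
        obtain ⟨i, hi⟩ := Function.ne_iff.1 h0
        have hlt : ∑ i, (a - c) i < ∑ i, a i := by
          refine Finset.sum_lt_sum (fun j _ => Nat.sub_le _ _) ⟨i, Finset.mem_univ i, ?_⟩
          have := hca i
          have hi : c i ≠ 0 := hi
          rw [Pi.sub_apply]
          have : c i ≤ a i := this
          omega
        omega
    · intro f g hf hg
      rw [map_add]
      exact (congrArg₂ (· + ·) hf hg).trans (add_zero 0)

/-- The functional `f ↦ (dualLift f)(η)` on polynomial functions. -/
noncomputable def liftFunctional : LocalCoh bW P →ₗ[k] Module.Dual k (Poly k V) where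
  toFun η :=
    { toFun := fun f => dualLift bW φ f (incl bW P η)
      map_add' := fun f g => by rw [map_add]; rfl
      map_smul' := fun r f => by rw [map_smul]; rfl }
  map_add' η η' := by
    ext f
    exact (congrArg (dualLift bW φ f).ofConv (map_add (incl bW P) η η')).trans
      (map_add (dualLift bW φ f).ofConv _ _)
  map_smul' r η := by
    ext f
    exact (congrArg (dualLift bW φ f).ofConv (map_smul (incl bW P) r η)).trans
      (map_smul (dualLift bW φ f).ofConv _ _)

/-- This finiteness is what lets local duality represent the functional by a class at `φ|0⟩_P`. On a
basis element the exponent is one more than its order. -/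
theorem liftFunctional_mem (η : LocalCoh bW P) :
    liftFunctional bW φ P η ∈ contDual bV (φ (incl bW P (vacuum bW P))) := by
  have hη : η ∈ Submodule.span k (Set.range (residueSymbol bW P)) := by
    rw [span_residueSymbol]; trivial
  induction hη using Submodule.span_induction with
  | mem η h =>
    obtain ⟨a, rfl⟩ := h
    exact ⟨∑ i, a i + 1, fun f hf =>
      dualLift_residueSymbol_eq_zero bW bV φ P rfl _ f hf a (Nat.lt_succ_self _)⟩
  | zero => rw [map_zero]; exact Submodule.zero_mem _
  | add η η' _ _ h h' => rw [map_add]; exact Submodule.add_mem _ h h'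
  | smul c η _ h => rw [map_smul]; exact Submodule.smul_mem _ c h

/-- The component at `P` of the coalgebra morphism lifting `φ`. -/
noncomputable def liftAt : LocalCoh bW P →ₗ[k] LocalCoh bV (φ (incl bW P (vacuum bW P))) :=
  (localDuality bV _).symm.toLinearMap ∘ₗ
    (liftFunctional bW φ P).codRestrict _ (liftFunctional_mem bW bV φ P)

theorem residue_smul_liftAt (f : Poly k V) (η : LocalCoh bW P) :
    residue bV _ (f • liftAt bW bV φ P η) = dualLift bW φ f (incl bW P η) := by
  rw [← localDuality_apply, liftAt]
  simp only [LinearMap.comp_apply, LinearEquiv.coe_coe, LinearEquiv.apply_symm_apply]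
  rfl

/-- Dual to the multiplicativity of `dualLift`, tested against pairs of polynomial functions. -/
theorem comul_liftAt (η : LocalCoh bW P) :
    Coalgebra.comul (R := k) (liftAt bW bV φ P η) =
      TensorProduct.map (liftAt bW bV φ P) (liftAt bW bV φ P) (Coalgebra.comul η) := by
  refine tensor_ext_of_residue bV _ fun f g => ?_
  rw [residuePairing_comul, residue_smul_liftAt, dualLift_mul_incl, TensorProduct.map_map]
  have h : ∀ f, (dualLift bW φ f).ofConv ∘ₗ incl bW P =
      (residuePairing bV _).flip f ∘ₗ liftAt bW bV φ P := fun f =>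
    LinearMap.ext fun η => (residue_smul_liftAt bW bV φ P f η).symm
  rw [h, h]

open scoped Classical in
/-- The linear map underlying the coalgebra morphism lifting `φ`. -/
noncomputable def liftLinear : Bang bW →ₗ[k] Bang bV :=
  DFinsupp.lsum ℕ fun P => incl bV _ ∘ₗ liftAt bW bV φ P

theorem liftLinear_incl (η : LocalCoh bW P) :
    liftLinear bW bV φ (incl bW P η) = incl bV _ (liftAt bW bV φ P η) := by
  classical
  exact DFinsupp.lsum_single _ _ _ _

theorem evalBang_liftLinear (f : Poly k V) (x : Bang bW) :
    evalBang bV f (liftLinear bW bV φ x) = dualLift bW φ f x := by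
  have h : evalBang bV f ∘ₗ liftLinear bW bV φ = (dualLift bW φ f).ofConv := by
    refine bang_hom_ext bW fun P η => ?_
    rw [LinearMap.comp_apply, liftLinear_incl, evalBang_incl, residue_smul_liftAt]
  exact congr($h x)

/-- The coalgebra morphism `!W → !V` lifting `φ : !W → V`. -/
noncomputable def lift : Bang bW →ₗc[k] Bang bV where
  toLinearMap := liftLinear bW bV φ
  counit_comp := by
    refine LinearMap.ext fun x => ?_
    rw [LinearMap.comp_apply, ← dualLift_one bW φ x, ← evalBang_liftLinear bW bV,
      ← pairingHom_apply, map_one]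
    rfl
  map_comp_comul := by
    refine bang_hom_ext bW fun P η => ?_
    rw [LinearMap.comp_apply, LinearMap.comp_apply, liftLinear_incl, comul_incl, comul_incl,
      comul_liftAt, TensorProduct.map_map, TensorProduct.map_map]
    congr 2
    all_goals
      ext1 η
      exact liftLinear_incl bW bV φ P η

theorem evalBang_lift (f : Poly k V) (x : Bang bW) :
    evalBang bV f (lift bW bV φ x) = dualLift bW φ f x :=
  evalBang_liftLinear bW bV φ f x

/-- Pairing with the coordinate forms reads off the coordinates of the dereliction, and `dualLift`
was prescribed on linear forms to match `φ`. -/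
theorem dereliction_comp_lift : dereliction bV ∘ₗ (lift bW bV φ).toLinearMap = φ := by
  refine LinearMap.ext fun x => bV.ext_elem fun i => ?_
  have := evalBang_lift bW bV φ (linForm (bV.coord i)) x
  rwa [evalBang_linForm, dualLift_linForm] at this

theorem eq_lift {Ψ : Bang bW →ₗc[k] Bang bV} (hΨ : dereliction bV ∘ₗ Ψ.toLinearMap = φ) :
    Ψ = lift bW bV φ :=
  CoalgHom.ext fun x => evalBang_ext bV fun f => by
    rw [evalBang_comp_of_lift bW bV φ hΨ, evalBang_lift]

/-! ### The sum over partitions -/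

variable {σ : Type*} [DecidableEq σ] (ν : σ → W)

theorem dualLift_mul_ket (I : Finset σ) (f g : Poly k V) :
    dualLift bW φ (f * g) (ket bW P I ν) =
      ∑ J ∈ I.powerset,
        dualLift bW φ f (ket bW P J ν) * dualLift bW φ g (ket bW P (I \ J) ν) := by
  rw [map_mul, LinearMap.convMul_apply, comul_ket, map_sum, map_sum]
  rfl

/-- The higher chain rule: the differential operator given by a ket at `P`, applied to the pullback
of `f`, as a sum over partitions. -/
theorem dualLift_ket {Q : V} (hQ : Q = φ (incl bW P (vacuum bW P))) {v : Finset σ → V}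
    (hv : ∀ B, φ (ket bW P B ν) = v B) (I : Finset σ) (f : Poly k V) :
    dualLift bW φ f (ket bW P I ν) =
      ∑ S ∈ partitionFamilies I, residue bV Q
        (diffOp k V (∏ B ∈ S, SymmetricAlgebra.ι k V (v B)) f • vacuum bV Q) := by
  -- With no derivatives both sides are evaluation of `f` at `Q`. This case is separate because
  -- `{I}` is not a partition of `I` when `I` is empty.
  have base : ∀ f : Poly k V, dualLift bW φ f (ket bW P ∅ ν) =
      ∑ S ∈ partitionFamilies ∅, residue bV Q
        (diffOp k V (∏ B ∈ S, SymmetricAlgebra.ι k V (v B)) f • vacuum bV Q) := by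
    intro f
    rw [ket_empty, dualLift_vacuum bW bV φ P hQ, partitionFamilies_empty,
      Finset.sum_singleton, Finset.prod_empty, map_one, Module.End.one_apply]
  induction f using poly_induction generalizing I with
  | algebraMap r =>
    by_cases hI : I = ∅
    · rw [hI, base]
    -- For nonempty `I` both sides vanish: the counit kills the ket, and every partition has a
    -- block, whose derivative kills constants.
    rw [AlgHom.commutes, LinearMap.convAlgebraMap_apply, counit_ket, if_neg hI, map_zero,
      smul_zero, Finset.sum_eq_zero]
    intro S hS
    rw [diffOp_prod_algebraMap, if_neg (nonempty_of_mem_partitionFamilies hI hS), zero_smul,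
      map_zero]
  | linForm ξ =>
    by_cases hI : I = ∅
    · rw [hI, base]
    -- Only the one-block partition differentiates a linear form exactly once; it gives `ξ (v I)`,
    -- which is `ξ` of `φ` on the ket.
    rw [dualLift_linForm, Finset.sum_eq_single_of_mem {I} (singleton_mem_partitionFamilies hI)]
    · rw [Finset.prod_singleton, diffOp_ι, partialDeriv_linForm, algebraMap_smul, map_smul,
        vacuum, residue_residueSymbol, if_pos rfl, smul_eq_mul, mul_one, hv]
    · intro S hS hne
      rw [diffOp_prod_linForm_eq_zero _ (one_lt_card_of_mem_partitionFamilies hI hS hne),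
        zero_smul, map_zero]
  | mul f g hf hg =>
    simp only [residue_diffOp_prod_mul]
    -- Leibniz on the right chooses which blocks act on `f`; the coproduct of the ket on the left
    -- chooses which indices do. Regrouping the blocks by the indices they cover matches the two
    -- sums.
    rw [sum_partitionFamilies_powerset I (fun D E =>
      residue bV Q (diffOp k V (∏ B ∈ D, SymmetricAlgebra.ι k V (v B)) f • vacuum bV Q) *
      residue bV Q (diffOp k V (∏ B ∈ E, SymmetricAlgebra.ι k V (v B)) g • vacuum bV Q)),
      dualLift_mul_ket]
    refine Finset.sum_congr rfl fun J _ => ?_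
    rw [hf, hg, Finset.sum_mul_sum]
  | add f g hf hg =>
    simp only [map_add, add_smul, Finset.sum_add_distrib]
    rw [← hf I, ← hg I]
    rfl

/-- By separation of points it suffices to pair with every `f`, which turns the identity into the
chain rule `dualLift_ket`. Since the comparison is made in `!V`, no transport between local
cohomology at `Q` and at `φ|0⟩_P` is needed. -/
theorem lift_ket {Q : V} (hQ : Q = φ (incl bW P (vacuum bW P))) (I : Finset σ) :
    lift bW bV φ (ket bW P I ν) =
      ∑ C : Finpartition I, incl bV Q (diffAct bV Q
        (∏ B ∈ C.parts, SymmetricAlgebra.ι k V (φ (ket bW P B ν))) (vacuum bV Q)) := by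
  refine evalBang_ext bV fun f => ?_
  rw [evalBang_lift, dualLift_ket bW bV φ P ν hQ (fun _ => rfl), sum_partitionFamilies I (fun S =>
    residue bV Q (diffOp k V
      (∏ B ∈ S, SymmetricAlgebra.ι k V (φ (ket bW P B ν))) f • vacuum bV Q)), map_sum]
  simp only [evalBang_incl_diffAct]

end Lift

end CofreeCoalgebra

theorem theorem2p16 {k : Type*} [Field k] [IsAlgClosed k] [CharZero k]
    {W V : Type*} [AddCommGroup W] [Module k W] [AddCommGroup V] [Module k V]
    {m n : ℕ} (bW : Module.Basis (Fin m) k W) (bV : Module.Basis (Fin n) k V)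
    (φ : Bang bW →ₗ[k] V) :
    ∃ Φ : Bang bW →ₗc[k] Bang bV,
      dereliction bV ∘ₗ Φ.toLinearMap = φ ∧
      (∀ Ψ : Bang bW →ₗc[k] Bang bV, dereliction bV ∘ₗ Ψ.toLinearMap = φ → Ψ = Φ) ∧
      ∀ (P : W) (s : ℕ) (ν : Fin s → W) (Q : V), Q = φ (incl bW P (vacuum bW P)) →
        Φ (ket bW P Finset.univ ν) =
          ∑ C : Finpartition (Finset.univ : Finset (Fin s)),
            incl bV Q (diffAct bV Q
              (∏ B ∈ C.parts, SymmetricAlgebra.ι k V (φ (ket bW P B ν))) (vacuum bV Q)) :=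
  ⟨lift bW bV φ, dereliction_comp_lift bW bV φ, fun _ hΨ => eq_lift bW bV φ hΨ,
    fun P _ ν _ hQ => lift_ket bW bV φ P ν hQ Finset.univ⟩
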